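/- Let $n,m\ge 1$ and $1<p<\infty$, with $p'=p/(p-1)$. A \emph{flag rectangle} is a set $R=I\times J\subset\mathbb R^n\times\mathbb R^m$ with $I\subset\mathbb R^n$, $J\subset\mathbb R^m$ axis-parallel cubes whose side lengths satisfy $0<\ell(I)\le\ell(J)$; let $\mathcal R_{\mathcal F}$ be the collection of these. A \emph{weight} is a locally integrable function on $\mathbb R^n\times\mathbb R^m$ that is positive almost everywhere, and $w\in A_{\mathcal F,p}$ means that $w$ is a weight with $$[w]_{A_{\mathcal F,p}}:=\sup_{R\in\mathcal R_{\mathcal F}}\Big(\frac1{|R|}\int_R w\Big)\Big(\frac1{|R|}\int_R w^{1-p'}\Big)^{p-1}<\infty .$$ A locally integrable complex-valued function $b$ on $\mathbb R^n\times\mathbb R^m$ belongs to $\mathrm{bmo}_{\mathcal F}$ if $$\|b\|_{\mathrm{bmo}_{\mathcal F}}:=\sup_{R\in\mathcal R_{\mathcal F}}\frac1{|R|}\int_R|b-\langle b\rangle_R|<\infty,\qquad \langle b\rangle_R=\frac1{|R|}\int_R b .$$ $L^p(w)$ denotes the space of complex measurable functions $f$, modulo equality almost everywhere, with $\|f\|_{L^p(w)}^p=\int|f|^p\,w<\infty$.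 Let $k\ge1$ and let $C:[0,\infty)^2\to[0,\infty)$ be nondecreasing in both variables. Then there is a function $C':[0,\infty)^2\to[0,\infty)$, nondecreasing in both variables and depending only on $n,m,p,k$ and $C$, such that the following holds. Let $\nu$ be a weight on $\mathbb R^n\times\mathbb R^m$, and let $T$ be a complex-linear operator from a linear space of (classes of) complex measurable functions on $\mathbb R^n\times\mathbb R^m$ into the space of all such functions. Suppose that, for all $\mu,\lambda\in A_{\mathcal F,p}$ with $\mu/\lambda=\nu^p$ almost everywhere, $T$ is defined on all of $L^p(\mu)$, maps it into $L^p(\lambda)$, and $$\|T\|_{L^p(\mu)\to L^p(\lambda)}\le C\big([\mu]_{A_{\mathcal F,p}},[\lambda]_{A_{\mathcal F,p}}\big).$$ Let $b_1,\dots,b_k\in\mathrm{bmo}_{\mathcal F}$, and let $C^k_{\vec b}(T)=[b_k,[b_{k-1},\cdots,[b_1,T]\cdots]]$, where $[b,S]f=b\,Sf-S(bf)$ is defined for those $f$ for which $f$ and $bf$ both lie in the domain of $S$. Then for all $\mu,\lambda\in A_{\mathcal F,p}$ with $\mu/\lambda=\nu^p$ almost everywhere, $C^k_{\vec b}(T)$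 is defined on all of $L^p(\mu)$, maps it into $L^p(\lambda)$, and $$\|C^k_{\vec b}(T)\|_{L^p(\mu)\to L^p(\lambda)}\le C'\big([\mu]_{A_{\mathcal F,p}},[\lambda]_{A_{\mathcal F,p}}\big)\prod_{j=1}^k\|b_j\|_{\mathrm{bmo}_{\mathcal F}} .$$ -/

import Mathlib

open MeasureTheory
open scoped ENNReal NNReal

noncomputable section

/-- The space `ℝⁿ × ℝᵐ`, with its Lebesgue measure `volume`. -/
abbrev FlagSpace (n m : ℕ) : Type := (Fin n → ℝ) × (Fin m → ℝ)

/-- Complex measurable functions on `ℝⁿ × ℝᵐ` modulo equality almost everywhere. -/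
abbrev FlagFun (n m : ℕ) : Type := FlagSpace n m →ₘ[volume] ℂ

/-- The axis-parallel (half-open) cube in `ℝᵈ` with corner `a` and side length `s`. -/
def halfOpenCube {d : ℕ} (a : Fin d → ℝ) (s : ℝ) : Set (Fin d → ℝ) :=
  Set.univ.pi fun i => Set.Ico (a i) (a i + s)

/-- Flag rectangles: products `I × J` of a cube `I ⊆ ℝⁿ` and a cube `J ⊆ ℝᵐ`
with side lengths `0 < ℓ(I) ≤ ℓ(J)`. -/
def flagRectangles (n m : ℕ) : Set (Set (FlagSpace n m)) :=
  {R | ∃ (a : Fin n → ℝ) (c : Fin m → ℝ) (s t : ℝ), 0 < s ∧ s ≤ t ∧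
    R = halfOpenCube a s ×ˢ halfOpenCube c t}

/-- The flag little bmo (semi)norm: the supremum over flag rectangles of the mean oscillation. -/
def flagBmoNorm {n m : ℕ} (b : FlagFun n m) : ℝ≥0∞ :=
  ⨆ R ∈ flagRectangles n m, ⨍⁻ x in R, ‖b x - ⨍ y in R, b y‖ₑ ∂volume

/-- The flag little bmo space. -/
def MemFlagBmo {n m : ℕ} (b : FlagFun n m) : Prop :=
  LocallyIntegrable b volume ∧ flagBmoNorm b < ∞

/-- A weight: a locally integrable function that is positive almost everywhere. -/
def IsFlagWeight {n m : ℕ} (w : FlagSpace n m → ℝ) : Prop :=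
  LocallyIntegrable w volume ∧ ∀ᵐ x, 0 < w x

/-- The flag Muckenhoupt characteristic `[w]_{A_{F,p}}`; the exponent is `1 - p'` with
`p' = p / (p - 1)` the Hölder conjugate of `p`. -/
def flagApChar {n m : ℕ} (p : ℝ) (w : FlagSpace n m → ℝ) : ℝ≥0∞ :=
  ⨆ R ∈ flagRectangles n m,
    (⨍⁻ x in R, ENNReal.ofReal (w x) ∂volume) *
      (⨍⁻ x in R, ENNReal.ofReal (w x ^ (1 - p.conjExponent)) ∂volume) ^ (p - 1)

/-- The class `A_{F,p}` of flag Muckenhoupt weights. -/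
def MemFlagAp {n m : ℕ} (p : ℝ) (w : FlagSpace n m → ℝ) : Prop :=
  IsFlagWeight w ∧ flagApChar p w < ∞

/-- The measure `w dx`; the weighted space `L^p(w)` is the Lebesgue space of this measure. -/
def weightMeasure {n m : ℕ} (w : FlagSpace n m → ℝ) : Measure (FlagSpace n m) :=
  volume.withDensity fun x => ENNReal.ofReal (w x)

/-- The pairs of weights `μ, λ ∈ A_{F,p}` with `μ / λ = ν ^ p`. -/
def IsWeightPair {n m : ℕ} (p : ℝ) (ν μ lam : FlagSpace n m → ℝ) : Prop :=
  MemFlagAp p μ ∧ MemFlagAp p lam ∧ ∀ᵐ x, μ x / lam x = ν x ^ p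

/-- `T` is defined on all of `L^p(μ)`, maps it to `L^p(λ)`, and `‖T‖_{L^p(μ) → L^p(λ)} ≤ K`. -/
def BoundedBetween {n m : ℕ} (p : ℝ) (T : FlagFun n m →ₗ.[ℂ] FlagFun n m)
    (μ lam : FlagSpace n m → ℝ) (K : ℝ≥0∞) : Prop :=
  ∀ f : FlagFun n m, MemLp f (ENNReal.ofReal p) (weightMeasure μ) →
    ∃ hf : f ∈ T.domain,
      MemLp (T ⟨f, hf⟩) (ENNReal.ofReal p) (weightMeasure lam) ∧
      eLpNorm (T ⟨f, hf⟩) (ENNReal.ofReal p) (weightMeasure lam) ≤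
        K * eLpNorm f (ENNReal.ofReal p) (weightMeasure μ)

/-- Multiplication by `b`, as a linear map. -/
def flagMul {n m : ℕ} (b : FlagFun n m) : FlagFun n m →ₗ[ℂ] FlagFun n m where
  toFun f := b * f
  map_add' f g := by
    induction b using AEEqFun.induction_on with | _ b hb
    induction f using AEEqFun.induction_on with | _ f hf
    induction g using AEEqFun.induction_on with | _ g hg
    simp only [AEEqFun.mk_add_mk, AEEqFun.mk_mul_mk, mul_add]
  map_smul' c f := by
    induction b using AEEqFun.induction_on with | _ b hb
    induction f using AEEqFun.induction_on with | _ f hf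
    simp only [AEEqFun.smul_mk, AEEqFun.mk_mul_mk, mul_smul_comm, RingHom.id_apply]

/-- The commutator `[b, T] f = b · T f - T (b · f)`, on its natural domain: all `f` such that
`f` and `b · f` lie in the domain of `T`. -/
def flagCommutator {n m : ℕ} (b : FlagFun n m) (T : FlagFun n m →ₗ.[ℂ] FlagFun n m) :
    FlagFun n m →ₗ.[ℂ] FlagFun n m where
  domain := T.domain ⊓ T.domain.comap (flagMul b)
  toFun :=
    { toFun := fun f => flagMul b (T ⟨f.1, f.2.1⟩) - T ⟨flagMul b f.1, f.2.2⟩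
      map_add' := by
        intro f g
        have h1 : (⟨(f + g).1, (f + g).2.1⟩ : T.domain) = ⟨f.1, f.2.1⟩ + ⟨g.1, g.2.1⟩ := rfl
        have h2 : (⟨flagMul b (f + g).1, (f + g).2.2⟩ : T.domain)
            = ⟨flagMul b f.1, f.2.2⟩ + ⟨flagMul b g.1, g.2.2⟩ :=
          Subtype.ext ((flagMul b).map_add f.1 g.1)
        rw [h1, h2, T.map_add, T.map_add, (flagMul b).map_add]
        abel
      map_smul' := by
        intro c f
        have h1 : (⟨(c • f).1, (c • f).2.1⟩ : T.domain) = c • ⟨f.1, f.2.1⟩ := rfl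
        have h2 : (⟨flagMul b (c • f).1, (c • f).2.2⟩ : T.domain) = c • ⟨flagMul b f.1, f.2.2⟩ :=
          Subtype.ext ((flagMul b).map_smul c f.1)
        rw [h1, h2, T.map_smul, T.map_smul, (flagMul b).map_smul, RingHom.id_apply, smul_sub] }

/-- The iterated commutator `[b_k, [b_{k-1}, ⋯, [b_1, T] ⋯]]`. -/
def iteratedCommutator {n m : ℕ} : (k : ℕ) → (Fin k → FlagFun n m) →
    (FlagFun n m →ₗ.[ℂ] FlagFun n m) → (FlagFun n m →ₗ.[ℂ] FlagFun n m)
  | 0, _, T => T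
  | k + 1, b, T => flagCommutator (b (Fin.last k)) (iteratedCommutator k (fun j => b j.castSucc) T)

end

/-! The engine is the Coifman–Rochberg–Weiss conjugation argument. Put `F z = e^{zb} T e^{-zb}`.
Formally `F' 0 = [b, T]`, so Cauchy's estimate bounds the commutator by `r⁻¹ sup ‖F z‖` over the
circle `|z| = r`. Multiplication by `e^{-zb}` is an isometry from `L^p(μ)` to `L^p(μ e^{p Re(zb)})`,
and likewise for `λ`, so the norm of `F z` is that of `T` for the pair `μ e^{p Re(zb)}`, `λ e^{p
Re(zb)}`. The ratio of this pair is still `ν ^ p`, so the hypothesis on `T` applies once the new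
weights are known to lie in the flag `A_p` class with controlled characteristic
(`eLpNorm_conjOp_le`, `eLpNorm_commutator_le`).

That control (`memFlagAp_mul_exp`) comes from a John–Nirenberg inequality on flag rectangles in
which Lebesgue measure is replaced by the weight or by its dual (`lintegral_exp_abs_sub_avg_le`).
Halving all sides splits a flag rectangle into flag rectangles, so a stopping-time argument runs
inside each of them. The only property of the measure it needs is that a subset with at most half of
the volume carries at most a proportion `1 - θ` of the mass. This follows from `A_p` and Hölder
(`doubles_of_flagApChar_le`), so no reverse Hölder inequality enters.

Analyticity needs care, since `e^{-zb} f` need not lie in `L^p(μ)`. It is expanded in `L^p(μ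
e^{-4pr|b|})`, where the decay absorbs the Taylor remainder, and this weight is again an admissible
perturbation. On the target side everything is restricted to `{|b| ≤ L}`, where `e^{zb}` is bounded.
The resulting curve in a Banach space is differentiable, and the Cauchy bound does not depend on
`L`.

Finally, `[b, T]` satisfies the hypothesis on `T` with a new constant, homogeneous in the old one,
so the argument iterates and the bmo norms multiply. -/

noncomputable section

/-! ### Flag rectangles and their dyadic children -/

/-- The data of a flag rectangle: the corners and the side lengths of its two cubes. -/
structure FlagBox (n m : ℕ) where
  a : Fin n → ℝ
  c : Fin m → ℝ
  s : ℝ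
  t : ℝ
  s_pos : 0 < s
  s_le : s ≤ t

/-- The corner of a dyadic child of a cube. -/
def childCorner {d : ℕ} (a : Fin d → ℝ) (s : ℝ) (e : Fin d → Bool) : Fin d → ℝ :=
  fun i => a i + if e i then s / 2 else 0

theorem mem_halfOpenCube {d : ℕ} {a x : Fin d → ℝ} {s : ℝ} :
    x ∈ halfOpenCube a s ↔ ∀ i, a i ≤ x i ∧ x i < a i + s := by
  simp [halfOpenCube, Set.mem_pi]

theorem measurableSet_halfOpenCube {d : ℕ} (a : Fin d → ℝ) (s : ℝ) :
    MeasurableSet (halfOpenCube a s) :=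
  MeasurableSet.univ_pi fun _ => measurableSet_Ico

theorem volume_halfOpenCube {d : ℕ} (a : Fin d → ℝ) (s : ℝ) :
    volume (halfOpenCube a s) = ENNReal.ofReal s ^ d := by
  simp [halfOpenCube, Real.volume_pi_Ico]

/-- The bit `e i` records in which half the `i`-th coordinate falls. With half-open cubes this makes
the children an exact partition. -/
theorem mem_childCorner_iff {d : ℕ} {a x : Fin d → ℝ} {s : ℝ} (hs : 0 < s) {e : Fin d → Bool} :
    x ∈ halfOpenCube (childCorner a s e) (s / 2) ↔
      x ∈ halfOpenCube a s ∧ ∀ i, (e i = true ↔ a i + s / 2 ≤ x i) := by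
  rw [mem_halfOpenCube, mem_halfOpenCube, ← forall_and]
  refine forall_congr' fun i => ?_
  unfold childCorner
  cases e i
  · simp only [Bool.false_eq_true, if_false, false_iff, not_le]
    constructor <;> intro h <;> refine ⟨?_, ?_⟩ <;> (try constructor) <;> grind
  · simp only [if_true, true_iff]
    constructor <;> intro h <;> refine ⟨?_, ?_⟩ <;> (try constructor) <;> grind

namespace FlagBox

variable {n m : ℕ}

/-- The flag rectangle with the given data. -/
def toSet (Q : FlagBox n m) : Set (FlagSpace n m) :=
  halfOpenCube Q.a Q.s ×ˢ halfOpenCube Q.c Q.t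

theorem t_pos (Q : FlagBox n m) : 0 < Q.t := Q.s_pos.trans_le Q.s_le

theorem measurableSet_toSet (Q : FlagBox n m) : MeasurableSet Q.toSet :=
  (measurableSet_halfOpenCube _ _).prod (measurableSet_halfOpenCube _ _)

theorem toSet_mem (Q : FlagBox n m) : Q.toSet ∈ flagRectangles n m :=
  ⟨Q.a, Q.c, Q.s, Q.t, Q.s_pos, Q.s_le, rfl⟩

theorem exists_of_mem {R : Set (FlagSpace n m)} (hR : R ∈ flagRectangles n m) :
    ∃ Q : FlagBox n m, R = Q.toSet := by
  obtain ⟨a, c, s, t, hs, hst, rfl⟩ := hR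
  exact ⟨⟨a, c, s, t, hs, hst⟩, rfl⟩

theorem volume_toSet (Q : FlagBox n m) :
    volume Q.toSet = ENNReal.ofReal (Q.s ^ n * Q.t ^ m) := by
  rw [toSet, Measure.volume_eq_prod, Measure.prod_prod, volume_halfOpenCube, volume_halfOpenCube,
    ENNReal.ofReal_mul (by have := Q.s_pos; positivity), ENNReal.ofReal_pow Q.s_pos.le,
    ENNReal.ofReal_pow Q.t_pos.le]

theorem volume_ne_zero (Q : FlagBox n m) : volume Q.toSet ≠ 0 := by
  rw [volume_toSet, Ne, ENNReal.ofReal_eq_zero, not_le]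
  have := Q.s_pos
  have := Q.t_pos
  positivity

theorem volume_ne_top (Q : FlagBox n m) : volume Q.toSet ≠ ∞ := by
  rw [volume_toSet]; exact ENNReal.ofReal_ne_top

theorem toSet_subset_Icc (Q : FlagBox n m) :
    Q.toSet ⊆ Set.Icc (Q.a, Q.c) (Q.a + fun _ => Q.s, Q.c + fun _ => Q.t) := by
  rintro ⟨x, y⟩ ⟨hx, hy⟩
  rw [mem_halfOpenCube] at hx hy
  exact ⟨⟨fun i => (hx i).1, fun i => (hy i).1⟩, ⟨fun i => (hx i).2.le, fun i => (hy i).2.le⟩⟩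

theorem integrableOn {E : Type*} [NormedAddCommGroup E] {f : FlagSpace n m → E}
    {μ : Measure (FlagSpace n m)} (hf : LocallyIntegrable f μ) (Q : FlagBox n m) :
    IntegrableOn f Q.toSet μ :=
  (hf.integrableOn_isCompact isCompact_Icc).mono_set Q.toSet_subset_Icc

/-- The dyadic children of a flag rectangle. -/
def child (Q : FlagBox n m) (e : (Fin n → Bool) × (Fin m → Bool)) : FlagBox n m :=
  ⟨childCorner Q.a Q.s e.1, childCorner Q.c Q.t e.2, Q.s / 2, Q.t / 2, half_pos Q.s_pos,
    by linarith [Q.s_le]⟩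

theorem iUnion_child (Q : FlagBox n m) : ⋃ e, (Q.child e).toSet = Q.toSet := by
  ext ⟨x, y⟩
  simp only [Set.mem_iUnion, toSet, child, Set.mem_prod, mem_childCorner_iff Q.s_pos,
    mem_childCorner_iff Q.t_pos]
  constructor
  · rintro ⟨e, h1, h2⟩
    exact ⟨h1.1, h2.1⟩
  · rintro ⟨h1, h2⟩
    exact ⟨(fun i => decide (Q.a i + Q.s / 2 ≤ x i), fun i => decide (Q.c i + Q.t / 2 ≤ y i)),
      ⟨h1, fun i => by simp⟩, ⟨h2, fun i => by simp⟩⟩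

theorem child_subset (Q : FlagBox n m) (e) : (Q.child e).toSet ⊆ Q.toSet := by
  rw [← iUnion_child Q]; exact Set.subset_iUnion (fun e => (Q.child e).toSet) e

theorem disjoint_child (Q : FlagBox n m) :
    Pairwise (Function.onFun Disjoint fun e => (Q.child e).toSet) := by
  intro e e' hne
  refine Set.disjoint_left.2 ?_
  rintro ⟨x, y⟩ h h'
  simp only [toSet, child, Set.mem_prod, mem_childCorner_iff Q.s_pos,
    mem_childCorner_iff Q.t_pos] at h h'
  refine hne (Prod.ext (funext fun i => ?_) (funext fun i => ?_))
  · exact Bool.eq_iff_iff.2 ((h.1.2 i).trans (h'.1.2 i).symm)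
  · exact Bool.eq_iff_iff.2 ((h.2.2 i).trans (h'.2.2 i).symm)

theorem volume_child (Q : FlagBox n m) (e) :
    volume Q.toSet = 2 ^ (n + m) * volume (Q.child e).toSet := by
  rw [volume_toSet, volume_toSet, ← ENNReal.ofReal_ofNat, ← ENNReal.ofReal_pow (by norm_num),
    ← ENNReal.ofReal_mul (by positivity)]
  congr 1
  simp only [child]
  rw [div_pow, div_pow, pow_add]
  field_simp

/-! ### Dyadic averages and Lebesgue differentiation -/

/-- The average of `h` over a flag rectangle. -/
def avg (h : FlagSpace n m → ℝ) (Q : FlagBox n m) : ℝ := ⨍ y in Q.toSet, h y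

/-- `|h_Q - c| |Q| ≤ ∫_Q |h - c|`. -/
theorem enorm_avg_sub_mul_volume_le {h : FlagSpace n m → ℝ} (hh : LocallyIntegrable h volume)
    (Q : FlagBox n m) (c : ℝ) :
    ‖Q.avg h - c‖ₑ * volume Q.toSet ≤ ∫⁻ x in Q.toSet, ‖h x - c‖ₑ := by
  have h1 : ∫ x in Q.toSet, (h x - c) = (volume.real Q.toSet) * (Q.avg h - c) := by
    have hpos : volume.real Q.toSet ≠ 0 :=
      (ENNReal.toReal_pos Q.volume_ne_zero Q.volume_ne_top).ne'
    rw [integral_sub (integrableOn hh Q) (integrableOn_const Q.volume_ne_top), avg, setAverage_eq,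
      setIntegral_const]
    simp only [smul_eq_mul]
    field_simp
  have h2 := enorm_integral_le_lintegral_enorm (μ := volume.restrict Q.toSet) fun x => h x - c
  rw [h1, enorm_mul] at h2
  rw [mul_comm]
  refine le_trans (le_of_eq ?_) h2
  congr 1
  rw [Real.enorm_eq_ofReal measureReal_nonneg, Measure.real, ENNReal.ofReal_toReal Q.volume_ne_top]

/-- If `∫_Q |h - c| ≤ a |Q|` then `|h_Q - c| ≤ a`. -/
theorem abs_avg_sub_le {h : FlagSpace n m → ℝ} (hh : LocallyIntegrable h volume)
    (Q : FlagBox n m) (c : ℝ) {a : ℝ} (ha : 0 ≤ a)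
    (hQ : ∫⁻ x in Q.toSet, ‖h x - c‖ₑ ≤ ENNReal.ofReal a * volume Q.toSet) :
    |Q.avg h - c| ≤ a := by
  have h1 := (enorm_avg_sub_mul_volume_le hh Q c).trans hQ
  rw [ENNReal.mul_le_mul_iff_left Q.volume_ne_zero Q.volume_ne_top] at h1
  rw [Real.enorm_eq_ofReal_abs] at h1
  exact (ENNReal.ofReal_le_ofReal_iff ha).1 h1

/-- The average of `h` over the dyadic descendant of generation `k` of `Q` that contains `x`. -/
def dyadicAvg (h : FlagSpace n m → ℝ) : ℕ → FlagBox n m → FlagSpace n m → ℝ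
  | 0, Q, _ => Q.avg h
  | k + 1, Q, x => ∑ e, (Q.child e).toSet.indicator (dyadicAvg h k (Q.child e)) x

theorem measurable_dyadicAvg (h : FlagSpace n m → ℝ) (k : ℕ) (Q : FlagBox n m) :
    Measurable (dyadicAvg h k Q) := by
  induction k generalizing Q with
  | zero => exact measurable_const
  | succ k ih =>
    exact Finset.measurable_fun_sum _ fun e _ =>
      (ih (Q.child e)).indicator (Q.child e).measurableSet_toSet

theorem dyadicAvg_succ_of_mem (h : FlagSpace n m → ℝ) (k : ℕ) (Q : FlagBox n m)
    {e : (Fin n → Bool) × (Fin m → Bool)} {x : FlagSpace n m} (hx : x ∈ (Q.child e).toSet) :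
    dyadicAvg h (k + 1) Q x = dyadicAvg h k (Q.child e) x := by
  rw [dyadicAvg, Finset.sum_eq_single e, Set.indicator_of_mem hx]
  · intro e' _ hne
    exact Set.indicator_of_notMem (fun hx' => Set.disjoint_left.1 (Q.disjoint_child hne) hx' hx) _
  · simp

theorem exists_dyadicAvg_eq (h : FlagSpace n m → ℝ) (k : ℕ) (Q : FlagBox n m)
    {x : FlagSpace n m} (hx : x ∈ Q.toSet) :
    ∃ P : FlagBox n m, x ∈ P.toSet ∧ P.s = Q.s / 2 ^ k ∧ P.t = Q.t / 2 ^ k ∧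
      dyadicAvg h k Q x = P.avg h := by
  induction k generalizing Q with
  | zero => exact ⟨Q, hx, by simp, by simp, rfl⟩
  | succ k ih =>
    rw [← iUnion_child Q, Set.mem_iUnion] at hx
    obtain ⟨e, he⟩ := hx
    obtain ⟨P, h1, h2, h3, h4⟩ := ih (Q.child e) he
    refine ⟨P, h1, ?_, ?_, by rw [dyadicAvg_succ_of_mem h k Q he, h4]⟩
    · rw [h2, child, pow_succ']; simp only; field_simp
    · rw [h3, child, pow_succ']; simp only; field_simp

theorem toSet_subset_closedBall (P : FlagBox n m) {x : FlagSpace n m} (hx : x ∈ P.toSet) :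
    P.toSet ⊆ Metric.closedBall x P.t := by
  rintro ⟨y1, y2⟩ ⟨hy1, hy2⟩
  obtain ⟨x1, x2⟩ := x
  obtain ⟨hx1, hx2⟩ := hx
  rw [mem_halfOpenCube] at hx1 hx2 hy1 hy2
  rw [← closedBall_prod_same]
  refine ⟨?_, ?_⟩
  · refine Metric.mem_closedBall.2 ((dist_pi_le_iff P.t_pos.le).2 fun i => ?_)
    rw [Real.dist_eq, abs_le]
    have := hx1 i; have := hy1 i; have := P.s_le
    simp only at *
    constructor <;> linarith
  · refine Metric.mem_closedBall.2 ((dist_pi_le_iff P.t_pos.le).2 fun i => ?_)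
    rw [Real.dist_eq, abs_le]
    have := hx2 i; have := hy2 i
    simp only at *
    constructor <;> linarith

/-- Lebesgue differentiation along the dyadic descendants of a flag rectangle. -/
theorem ae_tendsto_dyadicAvg {h : FlagSpace n m → ℝ} (hh : LocallyIntegrable h volume)
    (Q : FlagBox n m) :
    ∀ᵐ x, x ∈ Q.toSet →
      Filter.Tendsto (fun k => dyadicAvg h k Q x) Filter.atTop (nhds (h x)) := by
  filter_upwards [IsUnifLocDoublingMeasure.ae_tendsto_average_norm_sub volume hh 1] with x hx hxQ
  have hδ : Filter.Tendsto (fun k : ℕ => Q.t / 2 ^ k) Filter.atTop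
      (nhdsWithin 0 (Set.Ioi 0)) := by
    refine tendsto_nhdsWithin_iff.2 ⟨?_, Filter.Eventually.of_forall fun k => ?_⟩
    · have := tendsto_pow_atTop_nhds_zero_of_lt_one (r := (1 / 2 : ℝ)) (by norm_num) (by norm_num)
      simpa [div_eq_mul_inv] using this.const_mul Q.t
    · exact div_pos Q.t_pos (by positivity)
  have h1 := hx (fun _ : ℕ => x) (fun k : ℕ => Q.t / 2 ^ k) hδ
    (Filter.Eventually.of_forall fun k => Metric.mem_closedBall_self
      (by have := Q.t_pos; positivity))
  -- In the sup metric a ball of radius `P.t` is a cube of side `2 * P.t`. Halving preserves `t /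
  -- s`, so the ratio of its volume to that of `P` is this same `c` in every generation.
  set c : ℝ := 2 ^ (n + m) * Q.t ^ n / Q.s ^ n with hc
  have h2 := h1.const_mul c
  rw [mul_zero] at h2
  rw [tendsto_iff_norm_sub_tendsto_zero]
  refine squeeze_zero (fun _ => norm_nonneg _) (fun k => ?_) h2
  obtain ⟨P, hxP, hs, ht, hP⟩ := exists_dyadicAvg_eq h k Q hxQ
  rw [hP, ← ht]
  have hsp := Q.s_pos
  have htp := Q.t_pos
  have hint : IntegrableOn (fun y => h y - h x) (Metric.closedBall x P.t) volume :=
    (hh.integrableOn_isCompact (isCompact_closedBall _ _)).sub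
      (integrableOn_const (measure_closedBall_lt_top).ne)
  have hV : volume.real (Metric.closedBall x P.t) = c * volume.real P.toSet := by
    obtain ⟨x1, x2⟩ := x
    rw [← closedBall_prod_same, Measure.real, Measure.real, volume_toSet, Measure.volume_eq_prod,
      Measure.prod_prod, Real.volume_pi_closedBall _ P.t_pos.le,
      Real.volume_pi_closedBall _ P.t_pos.le, ENNReal.toReal_mul, ENNReal.toReal_ofReal,
      ENNReal.toReal_ofReal, ENNReal.toReal_ofReal, Fintype.card_fin, Fintype.card_fin, hc,
      hs, ht]
    · field_simp
      ring
    · have := P.s_pos; have := P.t_pos; positivity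
    · have := P.t_pos; positivity
    · have := P.t_pos; positivity
  have hVP : 0 < volume.real P.toSet := ENNReal.toReal_pos P.volume_ne_zero P.volume_ne_top
  have hcpos : 0 < c := by positivity
  have hsub := P.toSet_subset_closedBall hxP
  have h3 : P.avg h - h x = (volume.real P.toSet)⁻¹ * ∫ y in P.toSet, (h y - h x) := by
    rw [integral_sub (integrableOn hh P) (integrableOn_const P.volume_ne_top), avg, setAverage_eq,
      setIntegral_const]
    simp only [smul_eq_mul]
    field_simp
  rw [h3, setAverage_eq, hV, norm_mul, Real.norm_of_nonneg (inv_nonneg.2 hVP.le), smul_eq_mul,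
    mul_inv, ← mul_assoc, ← mul_assoc, mul_inv_cancel₀ hcpos.ne', one_mul]
  gcongr
  refine (norm_integral_le_integral_norm _).trans ?_
  exact setIntegral_mono_set hint.norm (Filter.Eventually.of_forall fun _ => norm_nonneg _)
    (Filter.Eventually.of_forall hsub)

/-! ### John–Nirenberg inequality by a stopping time -/

/-- The stopping-time construction: the set `E` is the union of the maximal dyadic descendants
of generation at most `j` on which the mean of `|h - c|` exceeds `a`. -/
theorem exists_stopping_set {h : FlagSpace n m → ℝ} (hh : LocallyIntegrable h volume)
    {μ : Measure (FlagSpace n m)} {K : ℝ≥0∞} {k : ℕ}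
    (hK : ∀ j < k, ∀ Q : FlagBox n m,
      ∫⁻ x in Q.toSet, ENNReal.ofReal (Real.exp |dyadicAvg h j Q x - Q.avg h|) ∂μ ≤
        K * μ Q.toSet)
    (c : ℝ) {a : ℝ} (ha : 0 ≤ a) (j : ℕ) (hj : j ≤ k) (Q : FlagBox n m)
    (hQ : ∫⁻ x in Q.toSet, ‖h x - c‖ₑ ≤ ENNReal.ofReal a * volume Q.toSet) :
    ∃ E ⊆ Q.toSet, MeasurableSet E ∧
      ENNReal.ofReal a * volume E ≤ ∫⁻ x in E, ‖h x - c‖ₑ ∧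
      ∫⁻ x in E, ENNReal.ofReal (Real.exp |dyadicAvg h j Q x - c|) ∂μ ≤
        ENNReal.ofReal (Real.exp (2 ^ (n + m) * a)) * K * μ E ∧
      ∀ x ∈ Q.toSet \ E, |dyadicAvg h j Q x - c| ≤ a := by
  induction j generalizing Q with
  | zero =>
    refine ⟨∅, Set.empty_subset _, MeasurableSet.empty, by simp, by simp, fun x _ => ?_⟩
    exact abs_avg_sub_le hh Q c ha hQ
  | succ j ih =>
    have key : ∀ e, ∃ E ⊆ (Q.child e).toSet, MeasurableSet E ∧
        ENNReal.ofReal a * volume E ≤ ∫⁻ x in E, ‖h x - c‖ₑ ∧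
        ∫⁻ x in E, ENNReal.ofReal (Real.exp |dyadicAvg h j (Q.child e) x - c|) ∂μ ≤
          ENNReal.ofReal (Real.exp (2 ^ (n + m) * a)) * K * μ E ∧
        ∀ x ∈ (Q.child e).toSet \ E, |dyadicAvg h j (Q.child e) x - c| ≤ a := by
      intro e
      by_cases hmean : ∫⁻ x in (Q.child e).toSet, ‖h x - c‖ₑ ≤
          ENNReal.ofReal a * volume (Q.child e).toSet
      · exact ih (by omega) (Q.child e) hmean
      · refine ⟨_, subset_rfl, (Q.child e).measurableSet_toSet, (not_le.1 hmean).le, ?_, by simp⟩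
        -- The parent was not stopped, so its mean is at most `a`. Passing to one child costs the
        -- ratio of the volumes.
        have h1 : |(Q.child e).avg h - c| ≤ 2 ^ (n + m) * a := by
          refine abs_avg_sub_le hh _ c (by positivity) ?_
          refine (lintegral_mono_set (Q.child_subset e)).trans (hQ.trans (le_of_eq ?_))
          rw [volume_child Q e, ENNReal.ofReal_mul (by positivity), ENNReal.ofReal_pow (by norm_num),
            ENNReal.ofReal_ofNat]
          ring
        calc ∫⁻ x in (Q.child e).toSet,
              ENNReal.ofReal (Real.exp |dyadicAvg h j (Q.child e) x - c|) ∂μ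
            ≤ ∫⁻ x in (Q.child e).toSet, ENNReal.ofReal (Real.exp (2 ^ (n + m) * a)) *
                ENNReal.ofReal
                  (Real.exp |dyadicAvg h j (Q.child e) x - (Q.child e).avg h|) ∂μ := by
              refine lintegral_mono fun x => ?_
              rw [← ENNReal.ofReal_mul (Real.exp_pos _).le, ← Real.exp_add]
              refine ENNReal.ofReal_le_ofReal (Real.exp_le_exp.2 ?_)
              have := abs_sub_le (dyadicAvg h j (Q.child e) x) ((Q.child e).avg h) c
              linarith
          _ = ENNReal.ofReal (Real.exp (2 ^ (n + m) * a)) * ∫⁻ x in (Q.child e).toSet,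
                ENNReal.ofReal
                  (Real.exp |dyadicAvg h j (Q.child e) x - (Q.child e).avg h|) ∂μ :=
              lintegral_const_mul' _ _ ENNReal.ofReal_ne_top
          _ ≤ _ := by
              rw [mul_assoc]
              gcongr
              exact hK j (by omega) _
    choose E hEsub hEmeas hE1 hE2 hE3 using key
    have hdisj : Pairwise (Function.onFun Disjoint E) := fun e e' hne =>
      (Q.disjoint_child hne).mono (hEsub e) (hEsub e')
    refine ⟨⋃ e, E e, ?_, MeasurableSet.iUnion hEmeas, ?_, ?_, ?_⟩
    · rw [← iUnion_child Q]
      exact Set.iUnion_mono hEsub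
    · rw [measure_iUnion hdisj hEmeas, lintegral_iUnion hEmeas hdisj, tsum_fintype, tsum_fintype,
        Finset.mul_sum]
      exact Finset.sum_le_sum fun e _ => hE1 e
    · rw [measure_iUnion hdisj hEmeas, lintegral_iUnion hEmeas hdisj, tsum_fintype, tsum_fintype,
        Finset.mul_sum]
      refine Finset.sum_le_sum fun e _ => (le_of_eq ?_).trans (hE2 e)
      refine setLIntegral_congr_fun (hEmeas e) fun x hx => ?_
      simp only [dyadicAvg_succ_of_mem h j Q (hEsub e hx)]
    · rintro x ⟨hxQ, hxE⟩
      rw [← iUnion_child Q, Set.mem_iUnion] at hxQ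
      obtain ⟨e, he⟩ := hxQ
      rw [dyadicAvg_succ_of_mem h j Q he]
      exact hE3 e x ⟨he, fun hx => hxE (Set.mem_iUnion.2 ⟨e, hx⟩)⟩

/-- A quantitative absolute continuity of `μ` with respect to Lebesgue measure on flag
rectangles. -/
def Doubles (μ : Measure (FlagSpace n m)) (θ : ℝ) : Prop :=
  ∀ (Q : FlagBox n m) (E : Set (FlagSpace n m)), MeasurableSet E → E ⊆ Q.toSet →
    2 * volume E ≤ volume Q.toSet → μ E ≤ ENNReal.ofReal (1 - θ) * μ Q.toSet

/-- Stop at height `2 * δ`. Off the stopping set the integrand is at most `1 + θ`. On it, strong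
induction on the generation applies to the stopped rectangles, which carry at most a proportion `1 -
θ` of the mass, at the price of a factor `1 + θ`. The bound is uniform in `k` because the product of
the two factors is `1 - θ ^ 2 < 1`. -/
theorem lintegral_exp_dyadicAvg_le {h : FlagSpace n m → ℝ} (hh : LocallyIntegrable h volume)
    {μ : Measure (FlagSpace n m)} {θ δ : ℝ} (hθ : 0 < θ) (hθ1 : θ ≤ 1) (hμ : Doubles μ θ)
    (hδ : 0 < δ) (hδθ : Real.exp (2 ^ (n + m) * (2 * δ)) ≤ 1 + θ)
    (hosc : ∀ Q : FlagBox n m,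
      ∫⁻ x in Q.toSet, ‖h x - Q.avg h‖ₑ ≤ ENNReal.ofReal δ * volume Q.toSet)
    (k : ℕ) (Q : FlagBox n m) :
    ∫⁻ x in Q.toSet, ENNReal.ofReal (Real.exp |dyadicAvg h k Q x - Q.avg h|) ∂μ ≤
      ENNReal.ofReal (2 / θ ^ 2) * μ Q.toSet := by
  induction k using Nat.strong_induction_on generalizing Q with
  | _ k IH =>
    have hQ : ∫⁻ x in Q.toSet, ‖h x - Q.avg h‖ₑ ≤ ENNReal.ofReal (2 * δ) * volume Q.toSet := by
      refine (hosc Q).trans ?_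
      gcongr
      linarith
    obtain ⟨E, hEQ, hE, hE1, hE2, hE3⟩ :=
      exists_stopping_set hh IH (Q.avg h) (a := 2 * δ) (by positivity) k le_rfl Q hQ
    -- Chebyshev: the threshold is twice the mean oscillation.
    have hvol : 2 * volume E ≤ volume Q.toSet := by
      have h1 := hE1.trans ((lintegral_mono_set hEQ).trans (hosc Q))
      rw [mul_comm 2 δ, ENNReal.ofReal_mul hδ.le, mul_assoc,
        ENNReal.mul_le_mul_iff_right (by simpa using hδ) ENNReal.ofReal_ne_top] at h1
      simpa using h1
    have hμE := hμ Q E hE hEQ hvol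
    have hexp2 : Real.exp (2 * δ) ≤ 1 + θ := by
      refine le_trans (Real.exp_le_exp.2 ?_) hδθ
      have : (1 : ℝ) ≤ 2 ^ (n + m) := one_le_pow₀ (by norm_num)
      nlinarith
    have hsplit := lintegral_inter_add_sdiff
      (μ := μ) (fun x => ENNReal.ofReal (Real.exp |dyadicAvg h k Q x - Q.avg h|)) Q.toSet hE
    rw [Set.inter_eq_self_of_subset_right hEQ] at hsplit
    rw [← hsplit]
    have hout : ∫⁻ x in Q.toSet \ E,
        ENNReal.ofReal (Real.exp |dyadicAvg h k Q x - Q.avg h|) ∂μ ≤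
          ENNReal.ofReal (1 + θ) * μ Q.toSet := by
      calc _ ≤ ∫⁻ x in Q.toSet \ E, ENNReal.ofReal (1 + θ) ∂μ := by
            refine setLIntegral_mono measurable_const fun x hx => ?_
            refine ENNReal.ofReal_le_ofReal (le_trans (Real.exp_le_exp.2 (hE3 x hx)) hexp2)
        _ = ENNReal.ofReal (1 + θ) * μ (Q.toSet \ E) := by rw [setLIntegral_const]
        _ ≤ _ := by gcongr; exact Set.sdiff_subset
    calc _ ≤ ENNReal.ofReal (1 + θ) * ENNReal.ofReal (2 / θ ^ 2) *
            (ENNReal.ofReal (1 - θ) * μ Q.toSet) + ENNReal.ofReal (1 + θ) * μ Q.toSet := by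
          refine add_le_add (hE2.trans ?_) hout
          gcongr
      _ = ENNReal.ofReal ((1 + θ) * (2 / θ ^ 2) * (1 - θ) + (1 + θ)) * μ Q.toSet := by
          have h0 : 0 ≤ 1 - θ := by linarith
          rw [ENNReal.ofReal_add (p := (1 + θ) * (2 / θ ^ 2) * (1 - θ)) (q := 1 + θ)
              (by positivity) (by positivity),
            ENNReal.ofReal_mul (by positivity), ENNReal.ofReal_mul (by positivity)]
          ring
      _ ≤ _ := by
          gcongr
          -- The constant `2 / θ ^ 2` is chosen so that the induction gains exactly `2`, which pays
          -- for the term `1 + θ ≤ 2` off the stopping set.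
          have : (1 + θ) * (2 / θ ^ 2) * (1 - θ) = 2 / θ ^ 2 - 2 := by field_simp; ring
          linarith

/-- The John–Nirenberg inequality on flag rectangles, with respect to the measure `μ`. -/
theorem lintegral_exp_abs_sub_avg_le {h : FlagSpace n m → ℝ} (hh : LocallyIntegrable h volume)
    {μ : Measure (FlagSpace n m)} (hac : μ ≪ volume) {θ δ : ℝ} (hθ : 0 < θ) (hθ1 : θ ≤ 1)
    (hμ : Doubles μ θ) (hδ : 0 < δ) (hδθ : Real.exp (2 ^ (n + m) * (2 * δ)) ≤ 1 + θ)
    (hosc : ∀ Q : FlagBox n m,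
      ∫⁻ x in Q.toSet, ‖h x - Q.avg h‖ₑ ≤ ENNReal.ofReal δ * volume Q.toSet)
    (Q : FlagBox n m) :
    ∫⁻ x in Q.toSet, ENNReal.ofReal (Real.exp |h x - Q.avg h|) ∂μ ≤
      ENNReal.ofReal (2 / θ ^ 2) * μ Q.toSet := by
  have hlim : ∀ᵐ x ∂(μ.restrict Q.toSet), Filter.Tendsto
      (fun k => ENNReal.ofReal (Real.exp |dyadicAvg h k Q x - Q.avg h|)) Filter.atTop
      (nhds (ENNReal.ofReal (Real.exp |h x - Q.avg h|))) := by
    rw [ae_restrict_iff' Q.measurableSet_toSet]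
    filter_upwards [hac.ae_le (ae_tendsto_dyadicAvg hh Q)] with x hx hxQ
    refine ENNReal.tendsto_ofReal ((Real.continuous_exp.tendsto _).comp ?_)
    exact ((hx hxQ).sub_const _).abs
  -- Fatou's lemma transfers the uniform bound for dyadic averages to `h`; the limit holds almost
  -- everywhere for `μ` by absolute continuity.
  calc _ = ∫⁻ x in Q.toSet, Filter.liminf
        (fun k => ENNReal.ofReal (Real.exp |dyadicAvg h k Q x - Q.avg h|)) Filter.atTop ∂μ :=
        lintegral_congr_ae (hlim.mono fun x hx => hx.liminf_eq.symm)
    _ ≤ _ := lintegral_liminf_le fun k => by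
        have := measurable_dyadicAvg h k Q
        fun_prop
    _ ≤ _ := Filter.liminf_le_of_le (by isBoundedDefault) fun b hb => by
        obtain ⟨k, hk⟩ := hb.exists
        exact hk.trans (lintegral_exp_dyadicAvg_le hh hθ hθ1 hμ hδ hδθ hosc k Q)

/-- Pass to complements: if `E` has at most half of the volume, then `Q \ E` has at least half,
hence at least the fraction `L⁻¹` of the mass. -/
theorem Doubles.of_le_mul {μ : Measure (FlagSpace n m)} {L : ℝ} (hL : 1 ≤ L)
    (hfin : ∀ Q : FlagBox n m, μ Q.toSet ≠ ∞)
    (h : ∀ (Q : FlagBox n m) (F : Set (FlagSpace n m)), MeasurableSet F → F ⊆ Q.toSet →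
      volume Q.toSet ≤ 2 * volume F → μ Q.toSet ≤ ENNReal.ofReal L * μ F) :
    Doubles μ L⁻¹ := by
  intro Q E hE hEQ hvol
  have hF : MeasurableSet (Q.toSet \ E) := MeasurableSet.diff Q.measurableSet_toSet hE
  have hVE : volume E ≠ ∞ := ne_top_of_le_ne_top Q.volume_ne_top (measure_mono hEQ)
  have hsum : ∀ τ : Measure (FlagSpace n m), τ Q.toSet = τ E + τ (Q.toSet \ E) := fun τ => by
    rw [← measure_union Set.disjoint_sdiff_right hF, Set.union_sdiff_cancel hEQ]
  have hV : volume Q.toSet ≤ 2 * volume (Q.toSet \ E) := by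
    have h1 : volume Q.toSet + volume Q.toSet ≤
        volume Q.toSet + 2 * volume (Q.toSet \ E) := by
      calc _ = 2 * volume E + 2 * volume (Q.toSet \ E) := by rw [hsum volume]; ring
        _ ≤ _ := by gcongr
    exact (ENNReal.add_le_add_iff_left Q.volume_ne_top).1 h1
  have h2 := h Q _ hF Set.sdiff_subset hV
  have hEt : μ E ≠ ∞ := ne_top_of_le_ne_top (hfin Q) (measure_mono hEQ)
  have hFt : μ (Q.toSet \ E) ≠ ∞ := ne_top_of_le_ne_top (hfin Q) (measure_mono Set.sdiff_subset)
  rw [hsum μ] at h2 ⊢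
  lift μ E to ℝ≥0 using hEt with e
  lift μ (Q.toSet \ E) to ℝ≥0 using hFt with f
  have hL0 : 0 < L := by linarith
  have hL1 : L⁻¹ ≤ 1 := inv_le_one_of_one_le₀ hL
  rw [ENNReal.ofReal, ← ENNReal.coe_add, ← ENNReal.coe_mul, ENNReal.coe_le_coe,
    ← NNReal.coe_le_coe] at h2 ⊢
  push_cast at h2 ⊢
  rw [Real.coe_toNNReal _ hL0.le] at h2
  rw [Real.coe_toNNReal _ (by linarith)]
  have h3 : L⁻¹ * (e + f : ℝ) ≤ f := by
    rw [inv_mul_le_iff₀ hL0]; exact h2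
  linarith

theorem Doubles.mono {μ : Measure (FlagSpace n m)} {θ θ' : ℝ} (h : Doubles μ θ) (hle : θ' ≤ θ) :
    Doubles μ θ' := fun Q E hE hEQ hv =>
  (h Q E hE hEQ hv).trans (by gcongr)

end FlagBox

/-! ### Flag Muckenhoupt weights and their dual weights -/

open FlagBox

variable {n m : ℕ}

theorem IsFlagWeight.aemeasurable {w : FlagSpace n m → ℝ} (hw : IsFlagWeight w) :
    AEMeasurable w volume :=
  hw.1.aestronglyMeasurable.aemeasurable

theorem weightMeasure_apply (w : FlagSpace n m → ℝ) {S : Set (FlagSpace n m)}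
    (hS : MeasurableSet S) :
    weightMeasure w S = ∫⁻ x in S, ENNReal.ofReal (w x) :=
  withDensity_apply _ hS

theorem weightMeasure_absolutelyContinuous (w : FlagSpace n m → ℝ) :
    weightMeasure w ≪ volume :=
  withDensity_absolutelyContinuous _ _

/-- The dual weight `w ^ (1 - p')`. -/
def dualWeight (p : ℝ) (w : FlagSpace n m → ℝ) : FlagSpace n m → ℝ :=
  fun x => w x ^ (1 - p.conjExponent)

theorem one_sub_conjExponent_mul {p : ℝ} (hp : 1 < p) : (1 - p.conjExponent) * (p - 1) = -1 := by
  have : p - 1 ≠ 0 := by linarith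
  rw [Real.conjExponent]; field_simp; ring

theorem one_lt_conjExponent {p : ℝ} (hp : 1 < p) : 1 < p.conjExponent :=
  (Real.HolderConjugate.conjExponent hp).symm.lt

/-- Hölder's inequality between a weight and its dual weight. -/
theorem volume_rpow_le {p : ℝ} (hp : 1 < p) {w : FlagSpace n m → ℝ} (hw : IsFlagWeight w)
    {F : Set (FlagSpace n m)} (hF : MeasurableSet F) :
    volume F ^ p ≤ weightMeasure w F * weightMeasure (dualWeight p w) F ^ (p - 1) := by
  have hpq := Real.HolderConjugate.conjExponent hp
  set q := p.conjExponent with hq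
  have hp0 : 0 < p := by linarith
  have hq0 : 0 < q := hpq.symm.pos
  have hm1 : AEMeasurable (fun x => ENNReal.ofReal (w x)) (volume.restrict F) :=
    hw.aemeasurable.restrict.ennreal_ofReal
  have hm2 : AEMeasurable (fun x => ENNReal.ofReal (dualWeight p w x)) (volume.restrict F) :=
    (hw.aemeasurable.restrict.pow_const _).ennreal_ofReal
  have h1 := ENNReal.lintegral_mul_le_Lp_mul_Lq (volume.restrict F) hpq
    (hm1.pow_const (1 / p)) (hm2.pow_const (1 / q))
  -- The two Hölder factors multiply to `1` almost everywhere, since `1 / p + (1 - q) / q = 0`.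
  have h2 : ∫⁻ x in F, ((fun x => ENNReal.ofReal (w x) ^ (1 / p)) *
      fun x => ENNReal.ofReal (dualWeight p w x) ^ (1 / q)) x = volume F := by
    rw [← setLIntegral_one]
    refine lintegral_congr_ae ?_
    filter_upwards [ae_restrict_of_ae hw.2] with x hx
    simp only [Pi.mul_apply, dualWeight]
    rw [ENNReal.ofReal_rpow_of_pos hx, ENNReal.ofReal_rpow_of_pos (Real.rpow_pos_of_pos hx _),
      ← ENNReal.ofReal_mul (by positivity), ← Real.rpow_mul hx.le, ← Real.rpow_add hx]
    have : 1 / p + (1 - q) * (1 / q) = 0 := by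
      have := hpq.inv_add_inv_eq_one
      field_simp
      field_simp at this
      linarith
    rw [hq] at this
    rw [this]
    simp
  rw [h2] at h1
  have e1 : ∀ y : ℝ≥0∞, (y ^ (1 / p)) ^ p = y := fun y => by
    rw [← ENNReal.rpow_mul, one_div_mul_cancel hp0.ne', ENNReal.rpow_one]
  have e2 : ∀ y : ℝ≥0∞, (y ^ (1 / q)) ^ q = y := fun y => by
    rw [← ENNReal.rpow_mul, one_div_mul_cancel hq0.ne', ENNReal.rpow_one]
  simp only [e1, e2] at h1
  rw [← weightMeasure_apply _ hF, ← weightMeasure_apply _ hF] at h1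
  calc volume F ^ p ≤ (weightMeasure w F ^ (1 / p) *
        weightMeasure (dualWeight p w) F ^ (1 / q)) ^ p := by gcongr
    _ = _ := by
        rw [ENNReal.mul_rpow_of_nonneg _ _ hp0.le, e1, ← ENNReal.rpow_mul]
        congr 2
        rw [hq, Real.conjExponent]
        field_simp

theorem laverage_mul_laverage_eq {p : ℝ} (hp : 1 < p) (Q : FlagBox n m) (A S : ℝ≥0∞) :
    A / volume Q.toSet * (S / volume Q.toSet) ^ (p - 1) =
      A * S ^ (p - 1) / volume Q.toSet ^ p := by
  have hp1 : 0 ≤ p - 1 := by linarith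
  rw [ENNReal.div_rpow_of_nonneg _ _ hp1]
  conv_rhs => rw [show p = 1 + (p - 1) by ring,
    ENNReal.rpow_add _ _ Q.volume_ne_zero Q.volume_ne_top, ENNReal.rpow_one]
  simp only [div_eq_mul_inv]
  rw [ENNReal.mul_inv (Or.inl Q.volume_ne_zero) (Or.inl Q.volume_ne_top),
    show 1 + (p - 1) - 1 = p - 1 by ring]
  ring

theorem flagApChar_eq {p : ℝ} (hp : 1 < p) (w : FlagSpace n m → ℝ) :
    flagApChar p w = ⨆ Q : FlagBox n m, weightMeasure w Q.toSet *
      weightMeasure (dualWeight p w) Q.toSet ^ (p - 1) / volume Q.toSet ^ p := by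
  have key : ∀ Q : FlagBox n m, (⨍⁻ x in Q.toSet, ENNReal.ofReal (w x) ∂volume) *
      (⨍⁻ x in Q.toSet, ENNReal.ofReal (w x ^ (1 - p.conjExponent)) ∂volume) ^ (p - 1) =
      weightMeasure w Q.toSet *
      weightMeasure (dualWeight p w) Q.toSet ^ (p - 1) / volume Q.toSet ^ p := fun Q => by
    rw [setLAverage_eq, setLAverage_eq, laverage_mul_laverage_eq hp,
      weightMeasure_apply _ Q.measurableSet_toSet, weightMeasure_apply _ Q.measurableSet_toSet]
    rfl
  apply le_antisymm
  · refine iSup₂_le fun R hR => ?_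
    obtain ⟨Q, rfl⟩ := exists_of_mem hR
    rw [key]
    exact le_iSup (fun Q : FlagBox n m => weightMeasure w Q.toSet *
      weightMeasure (dualWeight p w) Q.toSet ^ (p - 1) / volume Q.toSet ^ p) Q
  · refine iSup_le fun Q => ?_
    rw [← key]
    exact le_iSup₂ (f := fun R (_ : R ∈ flagRectangles n m) =>
      (⨍⁻ x in R, ENNReal.ofReal (w x) ∂volume) *
      (⨍⁻ x in R, ENNReal.ofReal (w x ^ (1 - p.conjExponent)) ∂volume) ^ (p - 1)) Q.toSet Q.toSet_mem

theorem volume_rpow_ne_zero {p : ℝ} (Q : FlagBox n m) :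
    volume Q.toSet ^ p ≠ 0 := by
  simp [ENNReal.rpow_eq_zero_iff, Q.volume_ne_zero, Q.volume_ne_top]

theorem volume_rpow_ne_top {p : ℝ} (hp : 1 < p) (Q : FlagBox n m) :
    volume Q.toSet ^ p ≠ ∞ :=
  ENNReal.rpow_ne_top_of_nonneg (by linarith) Q.volume_ne_top

theorem flagApChar_le_iff {p : ℝ} (hp : 1 < p) {w : FlagSpace n m → ℝ} {M : ℝ≥0∞} :
    flagApChar p w ≤ M ↔ ∀ Q : FlagBox n m, weightMeasure w Q.toSet *
      weightMeasure (dualWeight p w) Q.toSet ^ (p - 1) ≤ M * volume Q.toSet ^ p := by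
  rw [flagApChar_eq hp, iSup_le_iff]
  refine forall_congr' fun Q => ?_
  rw [ENNReal.div_le_iff (volume_rpow_ne_zero Q) (volume_rpow_ne_top hp Q)]

theorem IsFlagWeight.weightMeasure_ne_top {w : FlagSpace n m → ℝ} (hw : IsFlagWeight w)
    (Q : FlagBox n m) : weightMeasure w Q.toSet ≠ ∞ := by
  rw [weightMeasure_apply _ Q.measurableSet_toSet]
  exact (integrableOn hw.1 Q).lintegral_lt_top.ne

theorem weightMeasure_ne_zero {w : FlagSpace n m → ℝ} (hw : AEMeasurable w volume)
    (hpos : ∀ᵐ x, 0 < w x) (Q : FlagBox n m) : weightMeasure w Q.toSet ≠ 0 := by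
  rw [weightMeasure_apply _ Q.measurableSet_toSet]
  intro h0
  rw [lintegral_eq_zero_iff' hw.restrict.ennreal_ofReal] at h0
  have : ∀ᵐ x ∂(volume.restrict Q.toSet), False := by
    filter_upwards [h0, ae_restrict_of_ae hpos] with x hx hx'
    simp only [Pi.zero_apply, ENNReal.ofReal_eq_zero] at hx
    linarith
  rw [Filter.eventually_false_iff_eq_bot, ae_eq_bot, Measure.restrict_eq_zero] at this
  exact Q.volume_ne_zero this

theorem dualWeight_pos {p : ℝ} {w : FlagSpace n m → ℝ} (hw : IsFlagWeight w) :
    ∀ᵐ x, 0 < dualWeight p w x :=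
  hw.2.mono fun _ hx => Real.rpow_pos_of_pos hx _

theorem dualWeight_aemeasurable {p : ℝ} {w : FlagSpace n m → ℝ} (hw : IsFlagWeight w) :
    AEMeasurable (dualWeight p w) volume :=
  hw.aemeasurable.pow_const _

theorem weightMeasure_dualWeight_ne_top {p : ℝ} (hp : 1 < p) {w : FlagSpace n m → ℝ}
    (hw : MemFlagAp p w) (Q : FlagBox n m) : weightMeasure (dualWeight p w) Q.toSet ≠ ∞ := by
  intro htop
  have h1 := (flagApChar_le_iff hp).1 (le_refl (flagApChar p w)) Q
  rw [htop, ENNReal.top_rpow_of_pos (by linarith),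
    ENNReal.mul_top (weightMeasure_ne_zero hw.1.aemeasurable hw.1.2 Q), top_le_iff] at h1
  exact ENNReal.mul_ne_top hw.2.ne (volume_rpow_ne_top hp Q) h1

/-- The inverse of the constant in `Doubles` for a weight of characteristic at most `M`. -/
def apL (p M : ℝ) : ℝ := (2 ^ p * M) ^ p.conjExponent

/-- The admissible oscillation of the exponent for a weight of characteristic at most `M`. -/
def apDelta (n m : ℕ) (p M : ℝ) : ℝ := (4 * 2 ^ (n + m) * apL p M)⁻¹

/-- A bound for the characteristic of the perturbation of a weight of characteristic at
most `M`. -/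
def apTheta (p M : ℝ) : ℝ := (2 * apL p M ^ 2) ^ p * M

theorem one_le_two_rpow_mul {p M : ℝ} (hp : 1 < p) (hM : 1 ≤ M) : 1 ≤ 2 ^ p * M :=
  one_le_mul_of_one_le_of_one_le (Real.one_le_rpow (by norm_num) (by linarith)) hM

theorem one_le_apL {p M : ℝ} (hp : 1 < p) (hM : 1 ≤ M) : 1 ≤ apL p M :=
  Real.one_le_rpow (one_le_two_rpow_mul hp hM) (by linarith [one_lt_conjExponent hp])

theorem apL_mono {p M M' : ℝ} (hp : 1 < p) (hM : 1 ≤ M) (h : M ≤ M') : apL p M ≤ apL p M' := by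
  have := one_lt_conjExponent hp
  unfold apL
  gcongr

theorem apTheta_mono {p M M' : ℝ} (hp : 1 < p) (hM : 1 ≤ M) (h : M ≤ M') :
    apTheta p M ≤ apTheta p M' := by
  have := one_le_apL hp hM
  have := apL_mono hp hM h
  unfold apTheta
  gcongr

/-- With `θ` the inverse of `apL p M`, the exponent equals `θ / 2`, and `e^x ≤ 1 + x + x ^ 2`
suffices because `θ ≤ 1`. -/
theorem exp_apDelta_le {p M : ℝ} (hp : 1 < p) (hM : 1 ≤ M) :
    Real.exp (2 ^ (n + m) * (2 * apDelta n m p M)) ≤ 1 + (apL p M)⁻¹ := by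
  have hL := one_le_apL hp hM
  have h1 : 2 ^ (n + m) * (2 * apDelta n m p M) = (apL p M)⁻¹ / 2 := by
    rw [apDelta]; field_simp; norm_num
  rw [h1]
  have h2 : (apL p M)⁻¹ ≤ 1 := inv_le_one_of_one_le₀ hL
  have h3 : 0 < (apL p M)⁻¹ := by positivity
  have h4 := Real.abs_exp_sub_one_sub_id_le (x := (apL p M)⁻¹ / 2)
    (by rw [abs_of_pos (by positivity)]; linarith)
  rw [abs_le] at h4
  nlinarith [h4.2]

/-- Write `σ` for the dual weight. If `F` has at least half of the volume of `Q`, then `A_p` on `Q`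
and Hölder on `F` give `w(Q) σ(Q)^{p-1} ≤ 2^p M w(F) σ(F)^{p-1}`. Enlarging one of the two factors
on the right from `F` to `Q` and cancelling it leaves a comparison for the other measure. The two
constants are `2^p M` and its power `1 / (p - 1)`; the exponent `p'` in `apL` dominates both. -/
theorem doubles_of_flagApChar_le {p M : ℝ} (hp : 1 < p) (hM : 1 ≤ M) {w : FlagSpace n m → ℝ}
    (hw : MemFlagAp p w) (hwM : flagApChar p w ≤ ENNReal.ofReal M) :
    Doubles (weightMeasure w) (apL p M)⁻¹ ∧
      Doubles (weightMeasure (dualWeight p w)) (apL p M)⁻¹ := by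
  have hp1 : 0 < p - 1 := by linarith
  have hL1 := one_le_two_rpow_mul hp hM
  have key : ∀ (Q : FlagBox n m) (F : Set (FlagSpace n m)), MeasurableSet F → F ⊆ Q.toSet →
      volume Q.toSet ≤ 2 * volume F →
      weightMeasure w Q.toSet * weightMeasure (dualWeight p w) Q.toSet ^ (p - 1) ≤
        ENNReal.ofReal (2 ^ p * M) *
          (weightMeasure w F * weightMeasure (dualWeight p w) F ^ (p - 1)) := by
    intro Q F hF hFQ hv
    calc _ ≤ ENNReal.ofReal M * volume Q.toSet ^ p := (flagApChar_le_iff hp).1 hwM Q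
      _ ≤ ENNReal.ofReal M * (2 * volume F) ^ p := by gcongr
      _ = ENNReal.ofReal (2 ^ p * M) * volume F ^ p := by
          rw [ENNReal.mul_rpow_of_nonneg _ _ (by linarith), ENNReal.ofReal_mul (by positivity),
            ← ENNReal.ofReal_rpow_of_pos (by norm_num), ENNReal.ofReal_ofNat]
          ring
      _ ≤ _ := by gcongr; exact volume_rpow_le hp hw.1 hF
  constructor
  · refine (Doubles.of_le_mul hL1 hw.1.weightMeasure_ne_top fun Q F hF hFQ hv => ?_).mono ?_
    · have hS0 := weightMeasure_ne_zero (dualWeight_aemeasurable (p := p) hw.1)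
        (dualWeight_pos hw.1) Q
      have hSt := weightMeasure_dualWeight_ne_top hp hw Q
      have h1 := (key Q F hF hFQ hv).trans (mul_le_mul_right (mul_le_mul_right
        (ENNReal.rpow_le_rpow (measure_mono hFQ) hp1.le) _) _)
      rw [← mul_assoc, ENNReal.mul_le_mul_iff_left] at h1
      · exact h1
      · exact (ENNReal.rpow_pos (pos_iff_ne_zero.2 hS0) hSt).ne'
      · exact ENNReal.rpow_ne_top_of_nonneg hp1.le hSt
    · gcongr
      rw [apL]
      exact Real.self_le_rpow_of_one_le hL1 (one_lt_conjExponent hp).le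
  · refine (Doubles.of_le_mul (L := (2 ^ p * M) ^ (1 / (p - 1)))
      (Real.one_le_rpow hL1 (by positivity)) (weightMeasure_dualWeight_ne_top hp hw)
      fun Q F hF hFQ hv => ?_).mono ?_
    · have h1 := (key Q F hF hFQ hv).trans (mul_le_mul_right (mul_le_mul_left
        (measure_mono hFQ) _) _)
      rw [mul_left_comm, ENNReal.mul_le_mul_iff_right
        (weightMeasure_ne_zero hw.1.aemeasurable hw.1.2 Q) (hw.1.weightMeasure_ne_top Q)] at h1
      have h2 := ENNReal.rpow_le_rpow h1 (z := 1 / (p - 1)) (by positivity)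
      rw [ENNReal.mul_rpow_of_nonneg _ _ (by positivity), ← ENNReal.rpow_mul, ← ENNReal.rpow_mul,
        mul_one_div_cancel hp1.ne', ENNReal.rpow_one, ENNReal.rpow_one,
        ENNReal.ofReal_rpow_of_pos (by linarith)] at h2
      exact h2
    · gcongr
      rw [apL]
      refine Real.rpow_le_rpow_of_exponent_le hL1 ?_
      rw [Real.conjExponent]
      gcongr

/-! ### Perturbation of weights by exponentials of bmo functions -/

/-- `φ : ℂ → ℝ` is Lipschitz with constant `κ`. -/
def LipReal (κ : ℝ) (φ : ℂ → ℝ) : Prop := ∀ z w, |φ z - φ w| ≤ κ * ‖z - w‖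

theorem LipReal.continuous {κ : ℝ} {φ : ℂ → ℝ} (hφ : LipReal κ φ) : Continuous φ := by
  refine (LipschitzWith.of_dist_le_mul (K := κ.toNNReal) fun z w => ?_).continuous
  rw [Real.dist_eq, dist_eq_norm]
  exact (hφ z w).trans (by gcongr; exact Real.le_coe_toNNReal κ)

theorem LipReal.const_mul {κ : ℝ} {φ : ℂ → ℝ} (hφ : LipReal κ φ) (t : ℝ) :
    LipReal (|t| * κ) fun z => t * φ z := fun z w => by
  rw [← mul_sub, abs_mul, mul_assoc]
  exact mul_le_mul_of_nonneg_left (hφ z w) (abs_nonneg t)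

theorem LipReal.locallyIntegrable {κ : ℝ} {φ : ℂ → ℝ} (hφ : LipReal κ φ)
    {b : FlagFun n m} (hb : LocallyIntegrable b volume) :
    LocallyIntegrable (fun x => φ (b x)) volume := by
  have h1 : LocallyIntegrable (fun x => κ * ‖b x‖ + |φ 0|) volume := by
    refine LocallyIntegrable.add (LocallyIntegrable.smul (c := κ) (f := fun x => ‖b x‖) fun x => (hb x).norm) ?_
    exact locallyIntegrable_const _
  refine h1.mono ?_ (Filter.Eventually.of_forall fun x => ?_)
  · exact hφ.continuous.comp_aestronglyMeasurable b.aestronglyMeasurable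
  · have h2 := hφ (b x) 0
    rw [sub_zero] at h2
    rw [Real.norm_eq_abs]
    have h3 := abs_sub_abs_le_abs_sub (φ (b x)) (φ 0)
    exact le_trans (by linarith) (le_abs_self _)

/-- Compare first with the value of `φ` at the mean of `b`, where the Lipschitz bound is direct.
Replacing that value by the mean of `φ ∘ b` costs the factor `2`. -/
theorem LipReal.osc_le {κ B δ : ℝ} {φ : ℂ → ℝ} (hφ : LipReal κ φ) (hκ : 0 ≤ κ)
    {b : FlagFun n m} (hb : LocallyIntegrable b volume) (hB : flagBmoNorm b ≤ ENNReal.ofReal B)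
    (hδ : 2 * κ * B ≤ δ) (Q : FlagBox n m) :
    ∫⁻ x in Q.toSet, ‖φ (b x) - Q.avg (fun x => φ (b x))‖ₑ ≤
      ENNReal.ofReal δ * volume Q.toSet := by
  set h : FlagSpace n m → ℝ := fun x => φ (b x) with hh
  have hint := hφ.locallyIntegrable hb
  set c : ℝ := φ (⨍ y in Q.toSet, b y) with hc
  have h1 : ∫⁻ x in Q.toSet, ‖h x - c‖ₑ ≤ ENNReal.ofReal (κ * B) * volume Q.toSet := by
    have h2 : ⨍⁻ x in Q.toSet, ‖b x - ⨍ y in Q.toSet, b y‖ₑ ∂volume ≤ ENNReal.ofReal B :=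
      le_trans (le_iSup₂ (f := fun R (_ : R ∈ flagRectangles n m) =>
        ⨍⁻ x in R, ‖b x - ⨍ y in R, b y‖ₑ ∂volume) Q.toSet Q.toSet_mem) hB
    rw [setLAverage_eq, ENNReal.div_le_iff Q.volume_ne_zero Q.volume_ne_top] at h2
    calc _ ≤ ∫⁻ x in Q.toSet, ENNReal.ofReal κ * ‖b x - ⨍ y in Q.toSet, b y‖ₑ := by
          refine lintegral_mono fun x => ?_
          rw [← ofReal_norm, ← ofReal_norm, ← ENNReal.ofReal_mul hκ]
          exact ENNReal.ofReal_le_ofReal (hφ _ _)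
      _ = ENNReal.ofReal κ * ∫⁻ x in Q.toSet, ‖b x - ⨍ y in Q.toSet, b y‖ₑ :=
          lintegral_const_mul' _ _ ENNReal.ofReal_ne_top
      _ ≤ _ := by
          rw [ENNReal.ofReal_mul hκ, mul_assoc]
          gcongr
  have h3 := enorm_avg_sub_mul_volume_le hint Q c
  calc ∫⁻ x in Q.toSet, ‖h x - Q.avg h‖ₑ
      ≤ ∫⁻ x in Q.toSet, (‖h x - c‖ₑ + ‖Q.avg h - c‖ₑ) := by
        refine lintegral_mono fun x => ?_
        have : h x - Q.avg h = (h x - c) - (Q.avg h - c) := by ring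
        rw [this]
        exact enorm_sub_le
    _ = (∫⁻ x in Q.toSet, ‖h x - c‖ₑ) + ‖Q.avg h - c‖ₑ * volume Q.toSet := by
        rw [lintegral_add_right _ measurable_const, setLIntegral_const]
    _ ≤ ENNReal.ofReal (κ * B) * volume Q.toSet + ENNReal.ofReal (κ * B) * volume Q.toSet :=
        add_le_add h1 (h3.trans h1)
    _ = 2 * ENNReal.ofReal (κ * B) * volume Q.toSet := by ring
    _ ≤ _ := by
        rw [← ENNReal.ofReal_ofNat, ← ENNReal.ofReal_mul (by norm_num)]
        gcongr
        linarith

theorem apDelta_pos {p M : ℝ} (hp : 1 < p) (hM : 1 ≤ M) : 0 < apDelta n m p M := by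
  have := one_le_apL hp hM
  unfold apDelta
  positivity

/-- The mass of a perturbed weight on a flag rectangle. -/
theorem weightMeasure_mul_exp_le {v : FlagSpace n m → ℝ} (hv : AEMeasurable v volume)
    (hv0 : ∀ᵐ x, 0 < v x)
    {p M : ℝ} (hp : 1 < p) (hM : 1 ≤ M) (hD : Doubles (weightMeasure v) (apL p M)⁻¹)
    {h : FlagSpace n m → ℝ} (hh : LocallyIntegrable h volume)
    (hosc : ∀ Q : FlagBox n m,
      ∫⁻ x in Q.toSet, ‖h x - Q.avg h‖ₑ ≤ ENNReal.ofReal (apDelta n m p M) * volume Q.toSet)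
    (Q : FlagBox n m) :
    weightMeasure (fun x => v x * Real.exp (h x)) Q.toSet ≤
      ENNReal.ofReal (Real.exp (Q.avg h) * (2 * apL p M ^ 2)) * weightMeasure v Q.toSet := by
  have hL := one_le_apL hp hM
  have h1 := lintegral_exp_abs_sub_avg_le hh (weightMeasure_absolutelyContinuous v)
    (by positivity) (inv_le_one_of_one_le₀ hL) hD (apDelta_pos hp hM) (exp_apDelta_le hp hM) hosc Q
  rw [weightMeasure, setLIntegral_withDensity_eq_lintegral_mul₀ hv.ennreal_ofReal
    (by have := hh.aestronglyMeasurable.aemeasurable; fun_prop) Q.measurableSet_toSet,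
    ← weightMeasure, inv_pow, div_inv_eq_mul] at h1
  rw [weightMeasure_apply _ Q.measurableSet_toSet, ENNReal.ofReal_mul (Real.exp_pos _).le, mul_assoc]
  calc _ ≤ ∫⁻ x in Q.toSet, ENNReal.ofReal (Real.exp (Q.avg h)) *
        ((fun x => ENNReal.ofReal (v x)) * fun x => ENNReal.ofReal (Real.exp |h x - Q.avg h|)) x := by
        refine lintegral_mono_ae ?_
        filter_upwards [ae_restrict_of_ae hv0] with x hx
        rw [Pi.mul_apply, ← ENNReal.ofReal_mul hx.le, ← ENNReal.ofReal_mul (Real.exp_pos _).le]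
        refine ENNReal.ofReal_le_ofReal ?_
        rw [mul_left_comm, ← Real.exp_add]
        gcongr
        linarith [le_abs_self (h x - Q.avg h)]
    _ = _ := lintegral_const_mul' _ _ ENNReal.ofReal_ne_top
    _ ≤ _ := by gcongr

theorem locallyIntegrable_of_weightMeasure_ne_top {v : FlagSpace n m → ℝ}
    (hv : AEMeasurable v volume) (hv0 : ∀ᵐ x, 0 < v x)
    (hfin : ∀ Q : FlagBox n m, weightMeasure v Q.toSet ≠ ∞) : LocallyIntegrable v volume := by
  rintro ⟨x, y⟩
  let Q : FlagBox n m := ⟨fun i => x i - 1, fun i => y i - 1, 2, 2, by norm_num, le_rfl⟩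
  refine ⟨Q.toSet, ?_, hv.aestronglyMeasurable.restrict, ?_⟩
  · have : ∀ {d : ℕ} (x : Fin d → ℝ), halfOpenCube (fun i => x i - 1) 2 ∈ nhds x := fun x =>
      set_pi_mem_nhds Set.finite_univ fun i _ => Ico_mem_nhds (by linarith) (by linarith)
    exact prod_mem_nhds (this x) (this y)
  · rw [hasFiniteIntegral_iff_ofReal (ae_restrict_of_ae (hv0.mono fun _ h => h.le)),
      ← weightMeasure_apply _ Q.measurableSet_toSet]
    exact (hfin Q).lt_top

theorem avg_const_mul (t : ℝ) (h : FlagSpace n m → ℝ) (Q : FlagBox n m) :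
    Q.avg (fun x => t * h x) = t * Q.avg h := by
  simp only [avg, setAverage_eq, integral_const_mul, smul_eq_mul]
  ring

/-- Stability of the flag Muckenhoupt classes under small logarithmic perturbations. -/
theorem memFlagAp_mul_exp {p M κ B : ℝ} (hp : 1 < p) (hM : 1 ≤ M) {w : FlagSpace n m → ℝ}
    (hw : MemFlagAp p w) (hwM : flagApChar p w ≤ ENNReal.ofReal M) {φ : ℂ → ℝ}
    (hφ : LipReal κ φ) (hκ : 0 ≤ κ) (hB0 : 0 ≤ B) {b : FlagFun n m}
    (hb : LocallyIntegrable b volume)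
    (hB : flagBmoNorm b ≤ ENNReal.ofReal B)
    (hδ : 2 * κ * p.conjExponent * B ≤ apDelta n m p M) :
    MemFlagAp p (fun x => w x * Real.exp (φ (b x))) ∧
      flagApChar p (fun x => w x * Real.exp (φ (b x))) ≤ ENNReal.ofReal (apTheta p M) := by
  have hp' := one_lt_conjExponent hp
  obtain ⟨hD1, hD2⟩ := doubles_of_flagApChar_le hp hM hw hwM
  have hL := one_le_apL hp hM
  have hmb : AEMeasurable (fun x => φ (b x)) volume :=
    (hφ.continuous.comp_aestronglyMeasurable b.aestronglyMeasurable).aemeasurable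
  have hA := weightMeasure_mul_exp_le hw.1.aemeasurable hw.1.2 hp hM hD1
    (hφ.locallyIntegrable hb) (fun Q => hφ.osc_le hκ hb hB (by
      refine le_trans ?_ hδ
      have : 0 ≤ 2 * κ * B := by positivity
      nlinarith) Q)
  -- The dual of the perturbed weight is the dual weight perturbed by `(1 - p') φ(b)`. This is why
  -- the smallness assumption contains `p'`.
  have hφ' := hφ.const_mul (1 - p.conjExponent)
  have hS := weightMeasure_mul_exp_le (dualWeight_aemeasurable hw.1) (dualWeight_pos hw.1) hp hM hD2
    (hφ'.locallyIntegrable hb) (fun Q => hφ'.osc_le (by positivity) hb hB (by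
      refine le_trans ?_ hδ
      have h0 : |1 - p.conjExponent| ≤ p.conjExponent := by
        rw [abs_le]; constructor <;> linarith
      calc 2 * (|1 - p.conjExponent| * κ) * B = |1 - p.conjExponent| * (2 * κ * B) := by ring
        _ ≤ p.conjExponent * (2 * κ * B) := by gcongr
        _ = _ := by ring) Q)
  have hdual : weightMeasure (dualWeight p fun x => w x * Real.exp (φ (b x))) =
      weightMeasure fun x => dualWeight p w x * Real.exp ((1 - p.conjExponent) * φ (b x)) := by
    refine withDensity_congr_ae ?_
    filter_upwards [hw.1.2] with x hx
    simp only [dualWeight]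
    rw [Real.mul_rpow hx.le (Real.exp_pos _).le, ← Real.exp_mul, mul_comm (φ (b x))]
  have hmeas : AEMeasurable (fun x => w x * Real.exp (φ (b x))) volume :=
    hw.1.aemeasurable.mul hmb.exp
  have hpos : ∀ᵐ x, 0 < w x * Real.exp (φ (b x)) :=
    hw.1.2.mono fun x hx => mul_pos hx (Real.exp_pos _)
  have hchar : flagApChar p (fun x => w x * Real.exp (φ (b x))) ≤
      ENNReal.ofReal (apTheta p M) := by
    rw [flagApChar_le_iff hp]
    intro Q
    have hS' := hS Q
    rw [avg_const_mul] at hS'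
    rw [hdual]
    set c := Q.avg fun x => φ (b x) with hc
    set K : ℝ := 2 * apL p M ^ 2 with hK
    have hK0 : 0 < K := by positivity
    have hp1 : 0 ≤ p - 1 := by linarith
    calc _ ≤ ENNReal.ofReal (Real.exp c * K) * weightMeasure w Q.toSet *
          (ENNReal.ofReal (Real.exp ((1 - p.conjExponent) * c) * K) *
            weightMeasure (dualWeight p w) Q.toSet) ^ (p - 1) := by
          gcongr
          exact hA Q
      _ = ENNReal.ofReal (K ^ p) *
          (weightMeasure w Q.toSet * weightMeasure (dualWeight p w) Q.toSet ^ (p - 1)) := by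
          rw [ENNReal.mul_rpow_of_nonneg _ _ hp1, ENNReal.ofReal_rpow_of_pos (by positivity)]
          -- The means cancel: `(1 - p')(p - 1) = -1`, so the factors `e^c` and `e^{-c}` disappear
          -- and only `K ^ p` remains.
          have : K ^ p = Real.exp c * K *
              (Real.exp ((1 - p.conjExponent) * c) * K) ^ (p - 1) := by
            rw [Real.mul_rpow (Real.exp_pos _).le hK0.le, ← Real.exp_mul,
              mul_right_comm (1 - p.conjExponent) c, one_sub_conjExponent_mul hp]
            calc K ^ p = K ^ (1 + (p - 1)) := by ring_nf
              _ = K * K ^ (p - 1) := by rw [Real.rpow_add hK0, Real.rpow_one]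
              _ = (Real.exp c * Real.exp (-1 * c)) * (K * K ^ (p - 1)) := by
                  rw [← Real.exp_add]; simp
              _ = _ := by ring
          rw [this, ENNReal.ofReal_mul (p := Real.exp c * K) (by positivity)]
          ring
      _ ≤ ENNReal.ofReal (K ^ p) * (ENNReal.ofReal M * volume Q.toSet ^ p) := by
          gcongr ENNReal.ofReal (K ^ p) * ?_
          exact (flagApChar_le_iff hp).1 hwM Q
      _ = _ := by
          rw [← mul_assoc, ← ENNReal.ofReal_mul (by positivity), apTheta]
  refine ⟨⟨⟨locallyIntegrable_of_weightMeasure_ne_top hmeas hpos fun Q => ?_, hpos⟩,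
    hchar.trans_lt ENNReal.ofReal_lt_top⟩, hchar⟩
  exact ne_top_of_le_ne_top
    (ENNReal.mul_ne_top ENNReal.ofReal_ne_top (hw.1.weightMeasure_ne_top Q)) (hA Q)

/-! ### Weighted norms and exponential multipliers -/

theorem eLpNorm_weightMeasure {p : ℝ} (hp : 1 < p) {w : FlagSpace n m → ℝ}
    (hw : AEMeasurable w volume) {f : FlagSpace n m → ℂ} (hf : AEStronglyMeasurable f volume) :
    eLpNorm f (ENNReal.ofReal p) (weightMeasure w) =
      (∫⁻ x, ENNReal.ofReal (‖f x‖ ^ p * w x)) ^ (1 / p) := by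
  have hp0 : 0 < p := by linarith
  rw [eLpNorm_eq_lintegral_rpow_enorm_toReal (by simpa using hp0) ENNReal.ofReal_ne_top,
    ENNReal.toReal_ofReal hp0.le, weightMeasure,
    lintegral_withDensity_eq_lintegral_mul₀ hw.ennreal_ofReal (hf.enorm.pow_const p)]
  congr 1
  refine lintegral_congr fun x => ?_
  rw [Pi.mul_apply, ENNReal.ofReal_mul (by positivity), ← ofReal_norm,
    ENNReal.ofReal_rpow_of_nonneg (norm_nonneg _) hp0.le, mul_comm]

theorem eLpNorm_weightMeasure_le {p : ℝ} (hp : 1 < p) {w w' : FlagSpace n m → ℝ}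
    (hw : AEMeasurable w volume) (hw' : AEMeasurable w' volume) {f g : FlagSpace n m → ℂ}
    (hf : AEStronglyMeasurable f volume) (hg : AEStronglyMeasurable g volume) {c : ℝ} (hc : 0 ≤ c)
    (h : ∀ᵐ x, ‖g x‖ ^ p * w' x ≤ c ^ p * (‖f x‖ ^ p * w x)) :
    eLpNorm g (ENNReal.ofReal p) (weightMeasure w') ≤
      ENNReal.ofReal c * eLpNorm f (ENNReal.ofReal p) (weightMeasure w) := by
  have hp0 : 0 < p := by linarith
  rw [eLpNorm_weightMeasure hp hw hf, eLpNorm_weightMeasure hp hw' hg]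
  calc _ ≤ (∫⁻ x, ENNReal.ofReal (c ^ p) * ENNReal.ofReal (‖f x‖ ^ p * w x)) ^ (1 / p) := by
        refine ENNReal.rpow_le_rpow (lintegral_mono_ae ?_) (by positivity)
        filter_upwards [h] with x hx
        rw [← ENNReal.ofReal_mul (by positivity)]
        exact ENNReal.ofReal_le_ofReal hx
    _ = _ := by
        rw [lintegral_const_mul' _ _ ENNReal.ofReal_ne_top, ENNReal.mul_rpow_of_nonneg _ _
          (by positivity), ← ENNReal.ofReal_rpow_of_nonneg hc hp0.le, ← ENNReal.rpow_mul,
          mul_one_div_cancel hp0.ne', ENNReal.rpow_one]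

theorem coeFn_flagMul (b f : FlagFun n m) : ∀ᵐ x, flagMul b f x = b x * f x :=
  AEEqFun.coeFn_mul b f

/-- The function `exp (z b) f`. -/
def expMul (b : FlagFun n m) (z : ℂ) : FlagFun n m →ₗ[ℂ] FlagFun n m :=
  flagMul (AEEqFun.comp (fun w => Complex.exp (z * w)) (by fun_prop) b)

theorem coeFn_expMul (b : FlagFun n m) (z : ℂ) (f : FlagFun n m) :
    ∀ᵐ x, expMul b z f x = Complex.exp (z * b x) * f x := by
  filter_upwards [coeFn_flagMul (AEEqFun.comp (fun w => Complex.exp (z * w)) (by fun_prop) b) f,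
    AEEqFun.coeFn_comp (fun w => Complex.exp (z * w)) (by fun_prop) b] with x h1 h2
  rw [expMul, h1, h2, Function.comp]

theorem expMul_zero (b f : FlagFun n m) : expMul b 0 f = f := by
  refine AEEqFun.ext ?_
  filter_upwards [coeFn_expMul b 0 f] with x hx
  rw [hx]; simp

theorem norm_exp_mul_le {z w : ℂ} {r : ℝ} (hz : ‖z‖ ≤ r) :
    ‖Complex.exp (z * w)‖ ≤ Real.exp (r * ‖w‖) := by
  refine (Complex.norm_exp_le_exp_norm _).trans (Real.exp_le_exp.2 ?_)
  rw [norm_mul]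
  gcongr

theorem norm_exp_sub_one_le (w : ℂ) : ‖Complex.exp w - 1‖ ≤ ‖w‖ * Real.exp ‖w‖ := by
  have := Complex.norm_exp_sub_sum_le_norm_mul_exp w 1
  simpa using this

theorem norm_exp_sub_one_sub_le (w : ℂ) :
    ‖Complex.exp w - 1 - w‖ ≤ ‖w‖ ^ 2 * Real.exp ‖w‖ := by
  have := Complex.norm_exp_sub_sum_le_norm_mul_exp w 2
  simpa [Finset.sum_range_succ, sub_sub] using this

theorem le_div_mul_exp {r y : ℝ} (hr : 0 < r) : y ≤ r⁻¹ * Real.exp (r * y) := by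
  rw [inv_mul_eq_div, le_div_iff₀ hr]
  have := Real.add_one_le_exp (r * y)
  linarith

theorem mul_exp_le {r y : ℝ} (hr : 0 < r) (hy : 0 ≤ y) :
    y * Real.exp (r * y) ≤ r⁻¹ * Real.exp (4 * r * y) := by
  calc y * Real.exp (r * y) ≤ r⁻¹ * Real.exp (r * y) * Real.exp (r * y) := by
        gcongr; exact le_div_mul_exp hr
    _ = r⁻¹ * Real.exp (2 * r * y) := by rw [mul_assoc, ← Real.exp_add]; ring_nf
    _ ≤ _ := by gcongr; norm_num

/-- Powers of `|b|` are traded for exponentials. Here, in `mul_exp_le` and in `norm_expMul_le`,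
everything is brought to the common exponent `4 * r`, so that one auxiliary weight serves all three
estimates. -/
theorem sq_mul_exp_le {r y : ℝ} (hr : 0 < r) (hy : 0 ≤ y) :
    y ^ 2 * Real.exp (2 * r * y) ≤ r⁻¹ ^ 2 * Real.exp (4 * r * y) := by
  calc y ^ 2 * Real.exp (2 * r * y) ≤ (r⁻¹ * Real.exp (r * y)) ^ 2 * Real.exp (2 * r * y) := by
        gcongr; exact le_div_mul_exp hr
    _ = _ := by
        rw [mul_pow, mul_assoc, ← Real.exp_nat_mul, ← Real.exp_add]; push_cast; ring_nf

theorem aemeasurable_truncated_weight {lam : FlagSpace n m → ℝ} (hlam : AEMeasurable lam volume)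
    (b : FlagFun n m) (L : ℝ) : AEMeasurable (fun x => if ‖b x‖ ≤ L then lam x else 0) volume := by
  have hbm : Measurable fun x => ‖b x‖ := b.stronglyMeasurable.measurable.norm
  have hS : MeasurableSet {x | ‖b x‖ ≤ L} := measurableSet_le hbm measurable_const
  exact (hlam.indicator hS).congr (Filter.Eventually.of_forall fun x => by simp [Set.indicator])

/-- A bounded multiplier on `{|b| ≤ L}` is controlled by the weight `exp (-ε |b|) λ`. -/
theorem eLpNorm_indicator_weight_le {p ε L A : ℝ} (hp : 1 < p) (hε : 0 ≤ ε)
    {lam : FlagSpace n m → ℝ} (hlam : AEMeasurable lam volume) (hlam0 : ∀ᵐ x, 0 < lam x)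
    (b u v : FlagFun n m) (hA : 0 ≤ A) (h : ∀ᵐ x, ‖b x‖ ≤ L → ‖v x‖ ≤ A * ‖u x‖) :
    eLpNorm v (ENNReal.ofReal p) (weightMeasure fun x => if ‖b x‖ ≤ L then lam x else 0) ≤
      ENNReal.ofReal (A * Real.exp (ε / p * L)) *
        eLpNorm u (ENNReal.ofReal p)
          (weightMeasure fun x => lam x * Real.exp (-ε * ‖b x‖)) := by
  have hp0 : 0 < p := by linarith
  have hbm : Measurable fun x => ‖b x‖ := b.stronglyMeasurable.measurable.norm
  refine eLpNorm_weightMeasure_le hp (by fun_prop) ?_ u.aestronglyMeasurable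
    v.aestronglyMeasurable (by positivity) ?_
  · exact aemeasurable_truncated_weight hlam b L
  · filter_upwards [h, hlam0] with x hx hl
    split_ifs with hL
    · have h1 := hx hL
      rw [Real.mul_rpow hA (Real.exp_pos _).le, ← Real.exp_mul]
      calc ‖v x‖ ^ p * lam x ≤ (A * ‖u x‖) ^ p * lam x * 1 := by rw [mul_one]; gcongr
        _ ≤ (A * ‖u x‖) ^ p * lam x *
            (Real.exp (ε / p * L * p) * Real.exp (-ε * ‖b x‖)) := by
            gcongr
            rw [← Real.exp_add]
            refine Real.one_le_exp ?_
            have : ε / p * L * p = ε * L := by field_simp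
            rw [this]
            nlinarith
        _ = _ := by rw [Real.mul_rpow hA (norm_nonneg _)]; ring
    · have : 0 ≤ (A * Real.exp (ε / p * L)) ^ p *
          (‖u x‖ ^ p * (lam x * Real.exp (-ε * ‖b x‖))) := by positivity
      simpa using this

/-- Monotone convergence: the truncated weights increase to `lam` as `L → ∞`. It removes the
truncation once the bounds are uniform in `L`. -/
theorem eLpNorm_le_of_forall_indicator {p : ℝ} (hp : 1 < p)
    {lam : FlagSpace n m → ℝ} (hlam : AEMeasurable lam volume) (hlam0 : ∀ᵐ x, 0 < lam x)
    (b u : FlagFun n m) {X : ℝ≥0∞}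
    (h : ∀ L : ℕ, eLpNorm u (ENNReal.ofReal p)
      (weightMeasure fun x => if ‖b x‖ ≤ L then lam x else 0) ≤ X) :
    eLpNorm u (ENNReal.ofReal p) (weightMeasure lam) ≤ X := by
  have hp0 : 0 < p := by linarith
  have hbm : Measurable fun x => ‖b x‖ := b.stronglyMeasurable.measurable.norm
  have hm : ∀ L : ℕ, AEMeasurable (fun x => if ‖b x‖ ≤ L then lam x else 0) volume := fun L =>
    aemeasurable_truncated_weight hlam b L
  have hu : AEMeasurable (fun x => ‖u x‖ ^ p) volume :=
    (u.aestronglyMeasurable.norm.aemeasurable).pow_const p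
  rw [eLpNorm_weightMeasure hp hlam u.aestronglyMeasurable, one_div, ENNReal.rpow_inv_le_iff hp0]
  have hlim := lintegral_tendsto_of_tendsto_of_monotone (μ := volume)
    (f := fun (L : ℕ) x => ENNReal.ofReal (‖u x‖ ^ p * if ‖b x‖ ≤ L then lam x else 0))
    (F := fun x => ENNReal.ofReal (‖u x‖ ^ p * lam x))
    (fun L => (hu.mul (hm L)).ennreal_ofReal)
    (by
      filter_upwards [hlam0] with x hx L L' hLL'
      refine ENNReal.ofReal_le_ofReal ?_
      have : (L : ℝ) ≤ L' := by exact_mod_cast hLL'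
      gcongr
      split_ifs <;> linarith)
    (by
      refine Filter.Eventually.of_forall fun x => ?_
      obtain ⟨N, hN⟩ := exists_nat_ge ‖b x‖
      refine tendsto_const_nhds.congr' ?_
      filter_upwards [Filter.eventually_ge_atTop N] with L hL
      have : (N : ℝ) ≤ L := by exact_mod_cast hL
      rw [if_pos (hN.trans this)])
  refine le_of_tendsto' hlim fun L => ?_
  have := h L
  rwa [eLpNorm_weightMeasure hp (hm L) u.aestronglyMeasurable, one_div,
    ENNReal.rpow_inv_le_iff hp0] at this

/-- The weight `e^{-4pr|b|}` cancels exactly the `p`-th power of the growth `e^{4r|b|}`. -/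
theorem eLpNorm_le_of_norm_le_exp_mul {p r c : ℝ} (hp : 1 < p) (hc : 0 ≤ c)
    {μ : FlagSpace n m → ℝ} (hμ : AEMeasurable μ volume) (hμ0 : ∀ᵐ x, 0 < μ x)
    (b f u : FlagFun n m) (h : ∀ᵐ x, ‖u x‖ ≤ c * Real.exp (4 * r * ‖b x‖) * ‖f x‖) :
    eLpNorm u (ENNReal.ofReal p)
        (weightMeasure fun x => μ x * Real.exp (-(4 * p * r) * ‖b x‖)) ≤
      ENNReal.ofReal c * eLpNorm f (ENNReal.ofReal p) (weightMeasure μ) := by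
  have hp0 : 0 < p := by linarith
  have hbm : Measurable fun x => ‖b x‖ := b.stronglyMeasurable.measurable.norm
  refine eLpNorm_weightMeasure_le hp hμ (by fun_prop) f.aestronglyMeasurable
    u.aestronglyMeasurable hc ?_
  filter_upwards [h, hμ0] with x hx hμx
  calc _ ≤ (c * Real.exp (4 * r * ‖b x‖) * ‖f x‖) ^ p *
        (μ x * Real.exp (-(4 * p * r) * ‖b x‖)) := by gcongr
    _ = c ^ p * (‖f x‖ ^ p * μ x) *
        (Real.exp (4 * r * ‖b x‖ * p) * Real.exp (-(4 * p * r) * ‖b x‖)) := by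
        rw [Real.mul_rpow (by positivity) (norm_nonneg _), Real.mul_rpow hc (Real.exp_pos _).le,
          ← Real.exp_mul]
        ring
    _ = _ := by
        rw [← Real.exp_add, show 4 * r * ‖b x‖ * p + -(4 * p * r) * ‖b x‖ = 0 by ring,
          Real.exp_zero, mul_one]

/-! ### Taylor expansion of the conjugated operator -/

/-- The conjugated operator `exp (z b) S exp (- z b)`. -/
def conjOp (b : FlagFun n m) (S : FlagFun n m →ₗ[ℂ] FlagFun n m) (z : ℂ) :
    FlagFun n m →ₗ[ℂ] FlagFun n m :=
  expMul b z ∘ₗ S ∘ₗ expMul b (-z)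

/-- The derivative in `z` of the conjugated operator. -/
def conjOpDeriv (b : FlagFun n m) (S : FlagFun n m →ₗ[ℂ] FlagFun n m) (z : ℂ)
    (f : FlagFun n m) : FlagFun n m :=
  expMul b z (flagMul b (S (expMul b (-z) f)) - S (flagMul b (expMul b (-z) f)))

/-- The first-order Taylor remainder of `z ↦ exp (- z b) f`. -/
def expRemainder (b f : FlagFun n m) (z h : ℂ) : FlagFun n m :=
  expMul b (-(z + h)) f - expMul b (-z) f + h • flagMul b (expMul b (-z) f)

theorem norm_expRemainder_le {r : ℝ} (hr : 0 < r) (b f : FlagFun n m) {z h : ℂ} (hz : ‖z‖ ≤ r)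
    (hh : ‖h‖ ≤ r) :
    ∀ᵐ x, ‖expRemainder b f z h x‖ ≤
      (‖h‖ ^ 2 * r⁻¹ ^ 2) * Real.exp (4 * r * ‖b x‖) * ‖f x‖ := by
  have e1 := AEEqFun.coeFn_add (expMul b (-(z + h)) f - expMul b (-z) f)
    (h • flagMul b (expMul b (-z) f))
  have e2 := AEEqFun.coeFn_sub (expMul b (-(z + h)) f) (expMul b (-z) f)
  have e3 := AEEqFun.coeFn_smul h (flagMul b (expMul b (-z) f))
  filter_upwards [e1, e2, e3, coeFn_flagMul b (expMul b (-z) f), coeFn_expMul b (-z) f,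
    coeFn_expMul b (-(z + h)) f] with x h1 h2 h3 h4 h5 h6
  rw [expRemainder, h1, Pi.add_apply, h2, Pi.sub_apply, h3, Pi.smul_apply, h4, h5, h6, smul_eq_mul]
  have e : Complex.exp (-(z + h) * b x) * f x - Complex.exp (-z * b x) * f x +
      h * (b x * (Complex.exp (-z * b x) * f x)) =
      Complex.exp (-z * b x) * (Complex.exp (-(h * b x)) - 1 - -(h * b x)) * f x := by
    rw [show -(z + h) * b x = -z * b x + -(h * b x) by ring, Complex.exp_add]
    ring
  rw [e, norm_mul, norm_mul]
  refine mul_le_mul_of_nonneg_right ?_ (norm_nonneg _)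
  have b1 : ‖Complex.exp (-z * b x)‖ ≤ Real.exp (r * ‖b x‖) :=
    norm_exp_mul_le (by rwa [norm_neg])
  have b2 := norm_exp_sub_one_sub_le (-(h * b x))
  rw [norm_neg, norm_mul] at b2
  calc _ ≤ Real.exp (r * ‖b x‖) * ((‖h‖ * ‖b x‖) ^ 2 * Real.exp (r * ‖b x‖)) := by
        gcongr
        refine b2.trans ?_
        gcongr
    _ = ‖h‖ ^ 2 * (‖b x‖ ^ 2 * Real.exp (2 * r * ‖b x‖)) := by
        rw [show 2 * r * ‖b x‖ = r * ‖b x‖ + r * ‖b x‖ by ring, Real.exp_add]; ring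
    _ ≤ ‖h‖ ^ 2 * (r⁻¹ ^ 2 * Real.exp (4 * r * ‖b x‖)) := by
        exact mul_le_mul_of_nonneg_left (sq_mul_exp_le hr (norm_nonneg _)) (by positivity)
    _ = _ := by ring

theorem norm_expMul_le {r : ℝ} (hr : 0 < r) (b f : FlagFun n m) {z : ℂ} (hz : ‖z‖ ≤ 2 * r) :
    ∀ᵐ x, ‖expMul b z f x‖ ≤ 1 * Real.exp (4 * r * ‖b x‖) * ‖f x‖ := by
  filter_upwards [coeFn_expMul b z f] with x hx
  rw [hx, norm_mul, one_mul]
  gcongr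
  refine (norm_exp_mul_le hz).trans (Real.exp_le_exp.2 ?_)
  have : 0 ≤ r * ‖b x‖ := by positivity
  linarith

theorem norm_flagMul_expMul_le {r : ℝ} (hr : 0 < r) (b f : FlagFun n m) {z : ℂ} (hz : ‖z‖ ≤ r) :
    ∀ᵐ x, ‖flagMul b (expMul b z f) x‖ ≤ r⁻¹ * Real.exp (4 * r * ‖b x‖) * ‖f x‖ := by
  filter_upwards [coeFn_flagMul b (expMul b z f), coeFn_expMul b z f] with x hx hx'
  rw [hx, hx', norm_mul, norm_mul, ← mul_assoc]
  refine mul_le_mul_of_nonneg_right ?_ (norm_nonneg _)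
  exact (mul_le_mul_of_nonneg_left (norm_exp_mul_le hz) (norm_nonneg _)).trans
    (mul_exp_le hr (norm_nonneg _))

/-- The product rule with explicit remainder: the inner exponential contributes its Taylor remainder
under `S`, the outer one its own remainder, and the last term is the mixed one. Each is quadratic in
`h`. -/
theorem conjOp_remainder_eq (b : FlagFun n m) (S : FlagFun n m →ₗ[ℂ] FlagFun n m) (f : FlagFun n m)
    (z h : ℂ) :
    conjOp b S (z + h) f - conjOp b S z f - h • conjOpDeriv b S z f =
      expMul b (z + h) (S (expRemainder b f z h)) +
        (expMul b (z + h) (S (expMul b (-z) f)) - expMul b z (S (expMul b (-z) f)) -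
          h • flagMul b (expMul b z (S (expMul b (-z) f)))) -
        h • (expMul b (z + h) (S (flagMul b (expMul b (-z) f))) -
          expMul b z (S (flagMul b (expMul b (-z) f)))) := by
  have hcomm : ∀ u, flagMul b (expMul b z u) = expMul b z (flagMul b u) := fun u => by
    simp only [expMul, flagMul, LinearMap.coe_mk, AddHom.coe_mk]
    exact mul_left_comm _ _ _
  simp only [conjOp, conjOpDeriv, expRemainder, LinearMap.comp_apply, map_add, map_sub, map_smul,
    hcomm, smul_sub]
  abel

theorem ae_norm_expMul_le_of_le (b u : FlagFun n m) {r L : ℝ} {z : ℂ} (hr : 0 ≤ r) (hz : ‖z‖ ≤ r) :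
    ∀ᵐ x, ‖b x‖ ≤ L → ‖expMul b z u x‖ ≤ Real.exp (r * L) * ‖u x‖ := by
  filter_upwards [coeFn_expMul b z u] with x hx hL
  rw [hx, norm_mul]
  gcongr
  exact (norm_exp_mul_le hz).trans (by gcongr)

theorem ae_norm_expMul_sub_le (b u : FlagFun n m) {r L : ℝ} {z h : ℂ} (hz : ‖z‖ ≤ r)
    (hh : ‖h‖ ≤ r) :
    ∀ᵐ x, ‖b x‖ ≤ L → ‖(h • (expMul b (z + h) u - expMul b z u) : FlagFun n m) x‖ ≤
      (‖h‖ ^ 2 * (L * Real.exp (2 * r * L))) * ‖u x‖ := by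
  have e1 := AEEqFun.coeFn_smul h (expMul b (z + h) u - expMul b z u)
  have e2 := AEEqFun.coeFn_sub (expMul b (z + h) u) (expMul b z u)
  filter_upwards [e1, e2, coeFn_expMul b z u, coeFn_expMul b (z + h) u] with x h1 h2 h3 h4 hL
  have hr : 0 ≤ r := (norm_nonneg _).trans hz
  rw [h1, Pi.smul_apply, h2, Pi.sub_apply, h3, h4, smul_eq_mul, add_mul, Complex.exp_add]
  have e : h * (Complex.exp (z * b x) * Complex.exp (h * b x) * u x -
      Complex.exp (z * b x) * u x) =
      h * (Complex.exp (z * b x) * (Complex.exp (h * b x) - 1)) * u x := by ring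
  rw [e, norm_mul, norm_mul, norm_mul]
  refine mul_le_mul_of_nonneg_right ?_ (norm_nonneg _)
  have hL0 : 0 ≤ L := (norm_nonneg _).trans hL
  have b1 : ‖Complex.exp (z * b x)‖ ≤ Real.exp (r * L) :=
    (norm_exp_mul_le hz).trans (by gcongr)
  have b2 : ‖Complex.exp (h * b x) - 1‖ ≤ ‖h‖ * L * Real.exp (r * L) := by
    refine (norm_exp_sub_one_le _).trans ?_
    rw [norm_mul]
    gcongr
  calc _ ≤ ‖h‖ * (Real.exp (r * L) * (‖h‖ * L * Real.exp (r * L))) := by gcongr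
    _ = _ := by
      rw [show 2 * r * L = r * L + r * L by ring, Real.exp_add]; ring

theorem ae_norm_expMul_remainder_le (b u : FlagFun n m) {r L : ℝ} {z h : ℂ} (hz : ‖z‖ ≤ r)
    (hh : ‖h‖ ≤ r) :
    ∀ᵐ x, ‖b x‖ ≤ L → ‖(expMul b (z + h) u - expMul b z u -
        h • flagMul b (expMul b z u) : FlagFun n m) x‖ ≤
      (‖h‖ ^ 2 * (L ^ 2 * Real.exp (2 * r * L))) * ‖u x‖ := by
  have e0 := AEEqFun.coeFn_sub (expMul b (z + h) u - expMul b z u) (h • flagMul b (expMul b z u))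
  have e1 := AEEqFun.coeFn_smul h (flagMul b (expMul b z u))
  have e2 := AEEqFun.coeFn_sub (expMul b (z + h) u) (expMul b z u)
  filter_upwards [e0, e1, e2, coeFn_expMul b z u, coeFn_expMul b (z + h) u,
    coeFn_flagMul b (expMul b z u)] with x h0 h1 h2 h3 h4 h5 hL
  have hr : 0 ≤ r := (norm_nonneg _).trans hz
  rw [h0, Pi.sub_apply, h1, Pi.smul_apply, h2, Pi.sub_apply, h5, h3, h4, smul_eq_mul, add_mul,
    Complex.exp_add]
  have e : Complex.exp (z * b x) * Complex.exp (h * b x) * u x -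
      Complex.exp (z * b x) * u x - h * (b x * (Complex.exp (z * b x) * u x)) =
      Complex.exp (z * b x) * (Complex.exp (h * b x) - 1 - h * b x) * u x := by ring
  rw [e, norm_mul, norm_mul]
  refine mul_le_mul_of_nonneg_right ?_ (norm_nonneg _)
  have b1 : ‖Complex.exp (z * b x)‖ ≤ Real.exp (r * L) :=
    (norm_exp_mul_le hz).trans (by gcongr)
  have b2 : ‖Complex.exp (h * b x) - 1 - h * b x‖ ≤ (‖h‖ * L) ^ 2 * Real.exp (r * L) := by
    refine (norm_exp_sub_one_sub_le _).trans ?_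
    rw [norm_mul]
    gcongr
  calc _ ≤ Real.exp (r * L) * ((‖h‖ * L) ^ 2 * Real.exp (r * L)) := by gcongr
    _ = _ := by
      rw [show 2 * r * L = r * L + r * L by ring, Real.exp_add]; ring

/-- `S` is bounded from `L^p(μ)` to `L^p(λ)` with norm at most `K`. -/
def WeightedBound (p : ℝ) (S : FlagFun n m →ₗ[ℂ] FlagFun n m) (μ lam : FlagSpace n m → ℝ)
    (K : ℝ≥0∞) : Prop :=
  ∀ u : FlagFun n m, eLpNorm u (ENNReal.ofReal p) (weightMeasure μ) < ∞ →
    eLpNorm (S u) (ENNReal.ofReal p) (weightMeasure lam) ≤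
      K * eLpNorm u (ENNReal.ofReal p) (weightMeasure μ)

section Core

variable {p r : ℝ} {K : ℝ≥0} {μ lam : FlagSpace n m → ℝ} {b : FlagFun n m}
  {S : FlagFun n m →ₗ[ℂ] FlagFun n m}

theorem WeightedBound.eLpNorm_le (hp : 1 < p) (hμ : AEMeasurable μ volume) (hμ0 : ∀ᵐ x, 0 < μ x)
    (hS : WeightedBound p S (fun x => μ x * Real.exp (-(4 * p * r) * ‖b x‖))
      (fun x => lam x * Real.exp (-(4 * p * r) * ‖b x‖)) K) {f : FlagFun n m}
    (hf : eLpNorm f (ENNReal.ofReal p) (weightMeasure μ) < ∞) {u : FlagFun n m} {c : ℝ}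
    (hc : 0 ≤ c) (h : ∀ᵐ x, ‖u x‖ ≤ c * Real.exp (4 * r * ‖b x‖) * ‖f x‖) :
    eLpNorm (S u) (ENNReal.ofReal p)
        (weightMeasure fun x => lam x * Real.exp (-(4 * p * r) * ‖b x‖)) ≤
      ENNReal.ofReal c * (K * eLpNorm f (ENNReal.ofReal p) (weightMeasure μ)) := by
  have h1 := eLpNorm_le_of_norm_le_exp_mul hp hc hμ hμ0 b f u h
  refine (hS u (h1.trans_lt (ENNReal.mul_lt_top ENNReal.ofReal_lt_top hf))).trans ?_
  rw [mul_left_comm]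
  gcongr

/-- The remainder of the conjugated operator is quadratic. -/
theorem exists_eLpNorm_conjOp_remainder_le (hp : 1 < p) (hr : 0 < r)
    (hμ : AEMeasurable μ volume) (hμ0 : ∀ᵐ x, 0 < μ x)
    (hlam : AEMeasurable lam volume) (hlam0 : ∀ᵐ x, 0 < lam x)
    (hS : WeightedBound p S (fun x => μ x * Real.exp (-(4 * p * r) * ‖b x‖))
      (fun x => lam x * Real.exp (-(4 * p * r) * ‖b x‖)) K) {f : FlagFun n m}
    (hf : eLpNorm f (ENNReal.ofReal p) (weightMeasure μ) < ∞) {L : ℝ} (hL : 0 ≤ L) {z : ℂ}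
    (hz : ‖z‖ ≤ r) :
    ∃ X : ℝ≥0∞, X ≠ ∞ ∧ ∀ h : ℂ, ‖h‖ ≤ r →
      eLpNorm (conjOp b S (z + h) f - conjOp b S z f - h • conjOpDeriv b S z f : FlagFun n m)
        (ENNReal.ofReal p) (weightMeasure fun x => if ‖b x‖ ≤ L then lam x else 0) ≤
        ENNReal.ofReal (‖h‖ ^ 2) * X := by
  set q := ENNReal.ofReal p with hq
  have hq1 : 1 ≤ q := by rw [hq, ← ENNReal.ofReal_one]; exact ENNReal.ofReal_le_ofReal hp.le
  have hε : 0 ≤ 4 * p * r := by positivity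
  set N : ℝ≥0∞ := K * eLpNorm f q (weightMeasure μ) with hN
  have hNt : N ≠ ∞ := ENNReal.mul_ne_top ENNReal.coe_ne_top hf.ne
  set G : ℝ := Real.exp (4 * p * r / p * L) with hG
  have hzn : ‖-z‖ ≤ r := by rwa [norm_neg]
  have k1 := hS.eLpNorm_le hp hμ hμ0 hf (u := expMul b (-z) f) zero_le_one
    (norm_expMul_le hr b f (by linarith))
  have k2 := hS.eLpNorm_le hp hμ hμ0 hf (u := flagMul b (expMul b (-z) f)) (inv_nonneg.2 hr.le)
    (norm_flagMul_expMul_le hr b f hzn)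
  have hac : (weightMeasure fun x => if ‖b x‖ ≤ L then lam x else 0) ≪ volume :=
    weightMeasure_absolutelyContinuous _
  -- One summand for each term of `conjOp_remainder_eq`. The factor `G` is the cost of replacing `λ
  -- e^{-4pr|b|}` by `λ` on `{|b| ≤ L}`.
  refine ⟨ENNReal.ofReal (Real.exp (2 * r * L) * G) * (ENNReal.ofReal (r⁻¹ ^ 2) * N) +
    ENNReal.ofReal (L ^ 2 * Real.exp (2 * r * L) * G) * (ENNReal.ofReal 1 * N) +
    ENNReal.ofReal (L * Real.exp (2 * r * L) * G) * (ENNReal.ofReal r⁻¹ * N), by finiteness,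
    fun h hh => ?_⟩
  have k0 := hS.eLpNorm_le hp hμ hμ0 hf (u := expRemainder b f z h)
    (c := ‖h‖ ^ 2 * r⁻¹ ^ 2) (by positivity) (norm_expRemainder_le hr b f hz hh)
  have hzh : ‖z + h‖ ≤ 2 * r := (norm_add_le _ _).trans (by linarith)
  have t0 := (eLpNorm_indicator_weight_le hp hε hlam hlam0 b _ _ (Real.exp_pos _).le
    (ae_norm_expMul_le_of_le b (S (expRemainder b f z h)) (L := L) (by positivity) hzh)).trans
    (mul_le_mul_right k0 _)
  have t1 := (eLpNorm_indicator_weight_le hp hε hlam hlam0 b _ _ (by positivity)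
    (ae_norm_expMul_remainder_le b (S (expMul b (-z) f)) (L := L) hz hh)).trans
    (mul_le_mul_right k1 _)
  have t2 := (eLpNorm_indicator_weight_le hp hε hlam hlam0 b _ _ (by positivity)
    (ae_norm_expMul_sub_le b (S (flagMul b (expMul b (-z) f))) (L := L) hz hh)).trans
    (mul_le_mul_right k2 _)
  rw [conjOp_remainder_eq]
  set v0 := expMul b (z + h) (S (expRemainder b f z h))
  set v1 := expMul b (z + h) (S (expMul b (-z) f)) - expMul b z (S (expMul b (-z) f)) -
          h • flagMul b (expMul b z (S (expMul b (-z) f)))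
  set v2 := h • (expMul b (z + h) (S (flagMul b (expMul b (-z) f))) -
          expMul b z (S (flagMul b (expMul b (-z) f))))
  have hm : ∀ v : FlagFun n m, AEStronglyMeasurable v
      (weightMeasure fun x => if ‖b x‖ ≤ L then lam x else 0) := fun v =>
    v.aestronglyMeasurable.mono_ac hac
  have e1 : eLpNorm (v0 + v1 - v2 : FlagFun n m) q
      (weightMeasure fun x => if ‖b x‖ ≤ L then lam x else 0) =
      eLpNorm (⇑v0 + ⇑v1 - ⇑v2) q (weightMeasure fun x => if ‖b x‖ ≤ L then lam x else 0) := by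
    refine eLpNorm_congr_ae (hac.ae_le ?_)
    filter_upwards [AEEqFun.coeFn_sub (v0 + v1) v2, AEEqFun.coeFn_add v0 v1] with x h1 h2
    rw [h1, Pi.sub_apply, h2, Pi.sub_apply]
  rw [e1]
  refine (eLpNorm_sub_le ((hm v0).add (hm v1)) (hm v2) hq1).trans ?_
  refine (add_le_add_left (eLpNorm_add_le (hm v0) (hm v1) hq1) _).trans ?_
  refine (add_le_add (add_le_add t0 t1) t2).trans (le_of_eq ?_)
  have hh0 : (0 : ℝ) ≤ ‖h‖ ^ 2 := by positivity
  rw [mul_add, mul_add]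
  congr 1
  · congr 1
    · rw [ENNReal.ofReal_mul hh0]; ring
    · rw [mul_assoc (‖h‖ ^ 2), ENNReal.ofReal_mul hh0]; ring
  · rw [mul_assoc (‖h‖ ^ 2), ENNReal.ofReal_mul hh0]; ring

end Core

/-! ### Differentiability in a Banach space and Cauchy's estimate -/

/-- The classes with finite `L^q(τ)` norm form a subspace, and a linear map to `L^q(τ)` that is
isometric on this subspace extends to all classes. -/
theorem exists_linearMap_Lp (q : ℝ≥0∞) [Fact (1 ≤ q)] {τ : Measure (FlagSpace n m)}
    (hτ : τ ≪ volume) :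
    ∃ (V : Submodule ℂ (FlagFun n m)) (J : FlagFun n m →ₗ[ℂ] Lp ℂ q τ),
      (∀ u, u ∈ V ↔ eLpNorm u q τ < ∞) ∧ ∀ u ∈ V, ‖J u‖ = (eLpNorm u q τ).toReal := by
  have hm : ∀ v : FlagFun n m, AEStronglyMeasurable v τ := fun v =>
    v.aestronglyMeasurable.mono_ac hτ
  have hadd : ∀ u v : FlagFun n m, ⇑(u + v) =ᵐ[τ] ⇑u + ⇑v := fun u v =>
    hτ.ae_le (AEEqFun.coeFn_add u v)
  have hsmul : ∀ (c : ℂ) (u : FlagFun n m), ⇑(c • u) =ᵐ[τ] c • ⇑u := fun c u =>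
    hτ.ae_le (AEEqFun.coeFn_smul c u)
  let V : Submodule ℂ (FlagFun n m) :=
    { carrier := {u | MemLp u q τ}
      add_mem' := fun {u v} hu hv => (memLp_congr_ae (hadd u v)).2 (MemLp.add hu hv)
      zero_mem' := (memLp_congr_ae (hτ.ae_le AEEqFun.coeFn_zero)).2 MemLp.zero
      smul_mem' := fun c u hu => (memLp_congr_ae (hsmul c u)).2 (MemLp.const_smul hu c) }
  let J₀ : V →ₗ[ℂ] Lp ℂ q τ :=
    { toFun := fun u => MemLp.toLp u.1 u.2
      map_add' := fun u v => by
        rw [← MemLp.toLp_add]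
        exact MemLp.toLp_congr _ _ (hadd u.1 v.1)
      map_smul' := fun c u => by
        rw [RingHom.id_apply, ← MemLp.toLp_const_smul]
        exact MemLp.toLp_congr _ _ (hsmul c u.1) }
  -- An algebraic extension to all classes makes `J` linear on difference quotients before their
  -- membership in `V` is known; its values off `V` are never estimated.
  obtain ⟨J, hJ⟩ := J₀.exists_extend
  refine ⟨V, J, fun u => ⟨fun h => h.2, fun h => ⟨hm u, h⟩⟩, fun u hu => ?_⟩
  have : J u = J₀ ⟨u, hu⟩ := by rw [← hJ]; rfl
  rw [this]
  exact Lp.norm_toLp _ hu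

theorem hasDerivAt_of_quadratic {E : Type*} [NormedAddCommGroup E] [NormedSpace ℂ E] {F : ℂ → E}
    {F' : E} {z : ℂ} {r X : ℝ} (hr : 0 < r)
    (h : ∀ w : ℂ, ‖w‖ ≤ r → ‖F (z + w) - F z - w • F'‖ ≤ ‖w‖ ^ 2 * X) : HasDerivAt F F' z := by
  rw [hasDerivAt_iff_isLittleO_nhds_zero]
  have h1 : (fun w : ℂ => F (z + w) - F z - w • F') =O[nhds 0] fun w : ℂ => w ^ 2 := by
    refine Asymptotics.IsBigO.of_bound X ?_
    filter_upwards [Metric.closedBall_mem_nhds (0 : ℂ) hr] with w hw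
    rw [norm_pow, mul_comm]
    exact h w (by simpa using hw)
  exact h1.trans_isLittleO (by simpa using Asymptotics.isLittleO_pow_id (𝕜 := ℂ) one_lt_two)

section Core

variable {p r : ℝ} {K : ℝ≥0} {μ lam : FlagSpace n m → ℝ} {b : FlagFun n m}
  {S : FlagFun n m →ₗ[ℂ] FlagFun n m}

/-- The factors `e^{∓zb}` turn the weights `μ` and `λ` into their perturbations by `e^{p Re(zb)}`
isometrically, and truncating the target weight only lowers the norm. Hence the bound does not see
`L`. -/
theorem eLpNorm_conjOp_le (hp : 1 < p) (hμ : AEMeasurable μ volume)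
    (hlam : AEMeasurable lam volume) (hlam0 : ∀ᵐ x, 0 < lam x) {z : ℂ}
    (hS : WeightedBound p S (fun x => μ x * Real.exp (p * (z * b x).re))
      (fun x => lam x * Real.exp (p * (z * b x).re)) K) {f : FlagFun n m}
    (hf : eLpNorm f (ENNReal.ofReal p) (weightMeasure μ) < ∞) (L : ℝ) :
    eLpNorm (conjOp b S z f) (ENNReal.ofReal p)
        (weightMeasure fun x => if ‖b x‖ ≤ L then lam x else 0) ≤
      K * eLpNorm f (ENNReal.ofReal p) (weightMeasure μ) := by
  have hbm : Measurable fun x => b x := b.stronglyMeasurable.measurable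
  have h1 : eLpNorm (expMul b (-z) f) (ENNReal.ofReal p)
      (weightMeasure fun x => μ x * Real.exp (p * (z * b x).re)) ≤
      ENNReal.ofReal 1 * eLpNorm f (ENNReal.ofReal p) (weightMeasure μ) := by
    refine eLpNorm_weightMeasure_le hp hμ (by fun_prop) f.aestronglyMeasurable
      (AEEqFun.aestronglyMeasurable _) zero_le_one ?_
    filter_upwards [coeFn_expMul b (-z) f] with x hx
    rw [hx, norm_mul, Complex.norm_exp, Real.mul_rpow (Real.exp_pos _).le (norm_nonneg _),
      ← Real.exp_mul, neg_mul, Complex.neg_re, Real.one_rpow, one_mul]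
    refine le_of_eq ?_
    calc _ = ‖f x‖ ^ p * μ x *
          (Real.exp (-(z * b x).re * p) * Real.exp (p * (z * b x).re)) := by ring
      _ = _ := by rw [← Real.exp_add]; ring_nf; simp
  rw [ENNReal.ofReal_one, one_mul] at h1
  have h2 := hS _ (h1.trans_lt hf)
  refine le_trans ?_ (h2.trans (mul_le_mul_right h1 _))
  rw [conjOp, LinearMap.comp_apply, LinearMap.comp_apply]
  set u := S (expMul b (-z) f)
  refine le_trans (eLpNorm_weightMeasure_le hp (c := 1)
    (w := fun x => lam x * Real.exp (p * (z * b x).re)) (f := u) (by fun_prop)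
    (aemeasurable_truncated_weight hlam b L) u.aestronglyMeasurable
    (AEEqFun.aestronglyMeasurable _) zero_le_one ?_) (by rw [ENNReal.ofReal_one, one_mul])
  filter_upwards [coeFn_expMul b z u, hlam0] with x hx hl
  rw [hx, norm_mul, Complex.norm_exp, Real.mul_rpow (Real.exp_pos _).le (norm_nonneg _),
    ← Real.exp_mul, Real.one_rpow, one_mul]
  calc _ ≤ Real.exp ((z * b x).re * p) * ‖u x‖ ^ p * lam x := by
        gcongr
        split_ifs <;> linarith
    _ = _ := by ring_nf

/-- Cauchy's estimate for the derivative at `0` of `z ↦ exp (z b) S (exp (- z b) f)`. -/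
theorem eLpNorm_commutator_le (hp : 1 < p) (hr : 0 < r)
    (hμ : AEMeasurable μ volume) (hμ0 : ∀ᵐ x, 0 < μ x)
    (hlam : AEMeasurable lam volume) (hlam0 : ∀ᵐ x, 0 < lam x)
    (hS : WeightedBound p S (fun x => μ x * Real.exp (-(4 * p * r) * ‖b x‖))
      (fun x => lam x * Real.exp (-(4 * p * r) * ‖b x‖)) K)
    (hSz : ∀ z : ℂ, ‖z‖ ≤ r → WeightedBound p S (fun x => μ x * Real.exp (p * (z * b x).re))
      (fun x => lam x * Real.exp (p * (z * b x).re)) K) {f : FlagFun n m}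
    (hf : eLpNorm f (ENNReal.ofReal p) (weightMeasure μ) < ∞) :
    eLpNorm (flagMul b (S f) - S (flagMul b f) : FlagFun n m) (ENNReal.ofReal p)
        (weightMeasure lam) ≤
      K / ENNReal.ofReal r * eLpNorm f (ENNReal.ofReal p) (weightMeasure μ) := by
  refine eLpNorm_le_of_forall_indicator hp hlam hlam0 b _ fun L => ?_
  set q := ENNReal.ofReal p with hq
  have hq1 : 1 ≤ q := by rw [hq, ← ENNReal.ofReal_one]; exact ENNReal.ofReal_le_ofReal hp.le
  have : Fact (1 ≤ q) := ⟨hq1⟩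
  set τ : Measure (FlagSpace n m) :=
    weightMeasure fun x => if ‖b x‖ ≤ (L : ℝ) then lam x else 0 with hτ
  obtain ⟨V, J, hV, hJ⟩ := exists_linearMap_Lp q (τ := τ) (weightMeasure_absolutelyContinuous _)
  have hrem := fun (z : ℂ) (hz : ‖z‖ ≤ r) =>
    exists_eLpNorm_conjOp_remainder_le hp hr hμ hμ0 hlam hlam0 hS hf (L := L) (by positivity) hz
  rw [← hq, ← hτ] at hrem
  have hF : ∀ z : ℂ, ‖z‖ ≤ r → HasDerivAt (fun z => J (conjOp b S z f))
      (J (conjOpDeriv b S z f)) z := by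
    intro z hz
    obtain ⟨X, hX, hXb⟩ := hrem z hz
    refine hasDerivAt_of_quadratic (X := X.toReal) hr fun w hw => ?_
    have h1 := hXb w hw
    rw [← map_sub, ← map_smul, ← map_sub, hJ _ ((hV _).2 (h1.trans_lt (by finiteness)))]
    refine (ENNReal.toReal_mono (by finiteness) h1).trans (le_of_eq ?_)
    rw [ENNReal.toReal_mul, ENNReal.toReal_ofReal (by positivity)]
  have hbound : ∀ z : ℂ, ‖z‖ ≤ r → eLpNorm (conjOp b S z f) q τ ≤
      K * eLpNorm f q (weightMeasure μ) := fun z hz =>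
    eLpNorm_conjOp_le hp hμ hlam hlam0 (hSz z hz) hf L
  have hfin : K * eLpNorm f q (weightMeasure μ) < ∞ :=
    ENNReal.mul_lt_top ENNReal.coe_lt_top hf
  have hmem : ∀ z : ℂ, ‖z‖ ≤ r → conjOp b S z f ∈ V := fun z hz =>
    (hV _).2 ((hbound z hz).trans_lt hfin)
  have hd : DiffContOnCl ℂ (fun z => J (conjOp b S z f)) (Metric.ball 0 r) := by
    refine DifferentiableOn.diffContOnCl fun z hz => ?_
    refine (hF z ?_).differentiableAt.differentiableWithinAt
    rw [closure_ball _ hr.ne'] at hz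
    simpa using hz
  have hcauchy := Complex.norm_deriv_le_of_forall_mem_sphere_norm_le hr hd
    (C := (K * eLpNorm f q (weightMeasure μ)).toReal) fun z hz => by
      have hz' : ‖z‖ ≤ r := by simpa using (mem_sphere_zero_iff_norm.1 hz).le
      rw [hJ _ (hmem z hz')]
      exact ENNReal.toReal_mono hfin.ne (hbound z hz')
  rw [(hF 0 (by simpa using hr.le)).deriv] at hcauchy
  have hD : conjOpDeriv b S 0 f = flagMul b (S f) - S (flagMul b f) := by
    simp only [conjOpDeriv, neg_zero, expMul_zero]
  -- `J` computes norms only on `V`, so the derivative must be placed there. The expansion at `0`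
  -- with increment `r` writes `r` times the derivative as a difference of elements of `V`.
  have hDV : conjOpDeriv b S 0 f ∈ V := by
    obtain ⟨X, hX, hXb⟩ := hrem 0 (by simpa using hr.le)
    have hrn : ‖(r : ℂ)‖ ≤ r := by simp [abs_of_pos hr]
    have h1 := (hV _).2 ((hXb r hrn).trans_lt (by finiteness))
    have h2 := V.sub_mem (V.sub_mem (hmem (0 + r) (by simpa using hrn))
      (hmem 0 (by simpa using hr.le))) h1
    rw [sub_sub_cancel] at h2
    exact (V.smul_mem_iff (by exact_mod_cast hr.ne')).1 h2
  rw [hJ _ hDV, hD] at hcauchy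
  rw [hD, hV] at hDV
  rw [← ENNReal.ofReal_toReal hDV.ne]
  refine (ENNReal.ofReal_le_ofReal hcauchy).trans (le_of_eq ?_)
  rw [ENNReal.ofReal_div_of_pos hr, ENNReal.ofReal_toReal hfin.ne, div_eq_mul_inv, div_eq_mul_inv]
  ring

end Core

/-! ### The commutator of a partially defined operator -/

/-- The constant in the bound of a commutator, in terms of the one for the operator. -/
def commutatorConst (n m : ℕ) (p : ℝ) (C : ℝ≥0 → ℝ≥0 → ℝ≥0) (s t : ℝ≥0) : ℝ≥0 :=
  C (apTheta p (1 + s + t)).toNNReal (apTheta p (1 + s + t)).toNNReal *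
    (8 * p * p.conjExponent / apDelta n m p (1 + s + t)).toNNReal

theorem commutatorConst_mono {p : ℝ} (hp : 1 < p) {C : ℝ≥0 → ℝ≥0 → ℝ≥0}
    (hC : ∀ s s' t t' : ℝ≥0, s ≤ s' → t ≤ t' → C s t ≤ C s' t') (s s' t t' : ℝ≥0) (hs : s ≤ s')
    (ht : t ≤ t') : commutatorConst n m p C s t ≤ commutatorConst n m p C s' t' := by
  have h1 : (1 : ℝ) ≤ 1 + s + t := by linarith [s.2, t.2, s.coe_nonneg, t.coe_nonneg]
  have h2 : (1 : ℝ) + s + t ≤ 1 + s' + t' := by gcongr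
  have hΘ := Real.toNNReal_mono (apTheta_mono hp h1 h2)
  refine mul_le_mul' (hC _ _ _ _ hΘ hΘ) (Real.toNNReal_mono ?_)
  have hp' := one_lt_conjExponent hp
  have := apL_mono hp h1 h2
  simp only [apDelta, div_inv_eq_mul]
  gcongr

/-- Homogeneity in `C` lets the bmo norms of the earlier symbols pass through as a scalar, so the
final constant function does not depend on the symbols. -/
theorem commutatorConst_mul {p : ℝ} (C : ℝ≥0 → ℝ≥0 → ℝ≥0) (c : ℝ≥0) (s t : ℝ≥0) :
    commutatorConst n m p (fun s t => C s t * c) s t = commutatorConst n m p C s t * c := by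
  simp only [commutatorConst]; ring

theorem memLp_of_eLpNorm_lt_top {q : ℝ≥0∞} {w : FlagSpace n m → ℝ} {u : FlagFun n m}
    (h : eLpNorm u q (weightMeasure w) < ∞) : MemLp u q (weightMeasure w) :=
  ⟨u.aestronglyMeasurable.mono_ac (weightMeasure_absolutelyContinuous w), h⟩

theorem BoundedBetween.weightedBound {p : ℝ} {T : FlagFun n m →ₗ.[ℂ] FlagFun n m}
    {S : FlagFun n m →ₗ[ℂ] FlagFun n m} (hS : ∀ u (hu : u ∈ T.domain), S u = T ⟨u, hu⟩)
    {μ lam : FlagSpace n m → ℝ} {K : ℝ≥0∞} (hT : BoundedBetween p T μ lam K) :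
    WeightedBound p S μ lam K := fun u hu => by
  obtain ⟨hdom, -, hle⟩ := hT u (memLp_of_eLpNorm_lt_top hu)
  rwa [hS u hdom]

section Step

variable {p : ℝ} {C : ℝ≥0 → ℝ≥0 → ℝ≥0} {ν μ lam : FlagSpace n m → ℝ}
  {T : FlagFun n m →ₗ.[ℂ] FlagFun n m} {b : FlagFun n m}

/-- The operator remains bounded after a small logarithmic perturbation of both weights. -/
theorem boundedBetween_mul_exp (hp : 1 < p)
    (hC : ∀ s s' t t' : ℝ≥0, s ≤ s' → t ≤ t' → C s t ≤ C s' t')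
    (hT : ∀ μ lam : FlagSpace n m → ℝ, IsWeightPair p ν μ lam →
      BoundedBetween p T μ lam (C (flagApChar p μ).toNNReal (flagApChar p lam).toNNReal))
    (hpair : IsWeightPair p ν μ lam) {M : ℝ} (hM : 1 ≤ M)
    (hμM : flagApChar p μ ≤ ENNReal.ofReal M) (hlamM : flagApChar p lam ≤ ENNReal.ofReal M)
    {B κ : ℝ} (hB0 : 0 ≤ B) (hκ : 0 ≤ κ) (hb : LocallyIntegrable b volume)
    (hB : flagBmoNorm b ≤ ENNReal.ofReal B) {φ : ℂ → ℝ} (hφ : LipReal κ φ)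
    (hδ : 2 * κ * p.conjExponent * B ≤ apDelta n m p M) :
    BoundedBetween p T (fun x => μ x * Real.exp (φ (b x))) (fun x => lam x * Real.exp (φ (b x)))
      (C (apTheta p M).toNNReal (apTheta p M).toNNReal) := by
  obtain ⟨h1, h1'⟩ := memFlagAp_mul_exp hp hM hpair.1 hμM hφ hκ hB0 hb hB hδ
  obtain ⟨h2, h2'⟩ := memFlagAp_mul_exp hp hM hpair.2.1 hlamM hφ hκ hB0 hb hB hδ
  have h3 : IsWeightPair p ν (fun x => μ x * Real.exp (φ (b x)))
      (fun x => lam x * Real.exp (φ (b x))) := by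
    refine ⟨h1, h2, ?_⟩
    filter_upwards [hpair.2.2] with x hx
    rw [mul_div_mul_right _ _ (Real.exp_ne_zero _), hx]
  intro f hf
  obtain ⟨hdom, hmem, hle⟩ := hT _ _ h3 f hf
  refine ⟨hdom, hmem, hle.trans ?_⟩
  gcongr
  exact hC _ _ _ _ (ENNReal.toNNReal_mono ENNReal.ofReal_ne_top h1')
    (ENNReal.toNNReal_mono ENNReal.ofReal_ne_top h2')

theorem lipReal_neg_norm {κ : ℝ} : LipReal |κ| fun w => κ * ‖w‖ := fun z w => by
  rw [← mul_sub, abs_mul]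
  exact mul_le_mul_of_nonneg_left (abs_norm_sub_norm_le z w) (abs_nonneg _)

theorem lipReal_re {p : ℝ} (hp : 0 ≤ p) {z : ℂ} {r : ℝ} (hz : ‖z‖ ≤ r) :
    LipReal (p * r) fun w => p * (z * w).re := fun v w => by
  rw [← mul_sub, abs_mul, abs_of_nonneg hp, ← Complex.sub_re, ← mul_sub, mul_assoc]
  refine mul_le_mul_of_nonneg_left ?_ hp
  refine (Complex.abs_re_le_norm _).trans ?_
  rw [norm_mul]
  gcongr

/-- The commutator bound, with any positive majorant of the bmo norm. -/
theorem flagCommutator_bound_of_lt (hp : 1 < p)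
    (hC : ∀ s s' t t' : ℝ≥0, s ≤ s' → t ≤ t' → C s t ≤ C s' t')
    (hT : ∀ μ lam : FlagSpace n m → ℝ, IsWeightPair p ν μ lam →
      BoundedBetween p T μ lam (C (flagApChar p μ).toNNReal (flagApChar p lam).toNNReal))
    (hpair : IsWeightPair p ν μ lam) (hb : LocallyIntegrable b volume) {B : ℝ} (hB0 : 0 < B)
    (hB : flagBmoNorm b ≤ ENNReal.ofReal B) {f : FlagFun n m}
    (hf : MemLp f (ENNReal.ofReal p) (weightMeasure μ)) :
    ∃ hdom : f ∈ (flagCommutator b T).domain,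
      eLpNorm (flagCommutator b T ⟨f, hdom⟩) (ENNReal.ofReal p) (weightMeasure lam) ≤
        (commutatorConst n m p C (flagApChar p μ).toNNReal (flagApChar p lam).toNNReal : ℝ≥0∞) *
          ENNReal.ofReal B * eLpNorm f (ENNReal.ofReal p) (weightMeasure μ) := by
  set s := (flagApChar p μ).toNNReal with hs
  set t := (flagApChar p lam).toNNReal with ht
  set M : ℝ := 1 + s + t with hMdef
  have hM : 1 ≤ M := by linarith [s.coe_nonneg, t.coe_nonneg]
  have hμM : flagApChar p μ ≤ ENNReal.ofReal M := by
    rw [← ENNReal.coe_toNNReal hpair.1.2.ne, ← hs, ← ENNReal.ofReal_coe_nnreal]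
    exact ENNReal.ofReal_le_ofReal (by linarith [t.coe_nonneg])
  have hlamM : flagApChar p lam ≤ ENNReal.ofReal M := by
    rw [← ENNReal.coe_toNNReal hpair.2.1.2.ne, ← ht, ← ENNReal.ofReal_coe_nnreal]
    exact ENNReal.ofReal_le_ofReal (by linarith [s.coe_nonneg])
  have hp0 : 0 < p := by linarith
  have hp' : 0 < p.conjExponent := by linarith [one_lt_conjExponent hp]
  have hδ := apDelta_pos (n := n) (m := m) hp hM
  set δ := apDelta n m p M with hδdef
  -- The radius is dictated by the stronger perturbation `-4pr|b|`, of Lipschitz constant `4pr`, for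
  -- which the smallness condition becomes an equality. The perturbation `p Re(zb)` uses only a
  -- quarter of the allowance.
  set r : ℝ := δ / (8 * p * p.conjExponent * B) with hr
  have hr0 : 0 < r := by positivity
  have hrδ : 8 * p * r * p.conjExponent * B = δ := by rw [hr]; field_simp
  have hμm := hpair.1.1.aemeasurable
  have hlm := hpair.2.1.1.aemeasurable
  have hT1 := boundedBetween_mul_exp hp hC hT hpair hM hμM hlamM hB0.le (abs_nonneg _) hb hB
    (lipReal_neg_norm (κ := -(4 * p * r))) (by
      rw [abs_neg, abs_of_pos (by positivity), ← hδdef, ← hrδ]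
      exact le_of_eq (by ring))
  have hT2 := fun (z : ℂ) (hz : ‖z‖ ≤ r) => boundedBetween_mul_exp hp hC hT hpair hM hμM hlamM
    hB0.le (by positivity) hb hB (lipReal_re hp0.le hz) (by
      rw [← hδdef, ← hrδ]
      have : 0 ≤ p * r * p.conjExponent * B := by positivity
      linarith)
  -- A total linear extension of `T` is harmless: the bounds on `S` concern functions of finite
  -- weighted norm, and these lie in the domain of `T`.
  obtain ⟨S, hS⟩ := T.toFun.exists_extend
  have hS' : ∀ u (hu : u ∈ T.domain), S u = T ⟨u, hu⟩ := fun u hu =>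
    LinearMap.congr_fun hS ⟨u, hu⟩
  obtain ⟨hfd, -, -⟩ := hT μ lam hpair f hf
  -- `b f` may fail to be in `L^p(μ)`, but it lies in the space with the decaying weight, and `T` is
  -- defined on that space as well.
  have hbf : eLpNorm (flagMul b f) (ENNReal.ofReal p)
      (weightMeasure fun x => μ x * Real.exp (-(4 * p * r) * ‖b x‖)) < ∞ := by
    have h1 := norm_flagMul_expMul_le hr0 b f (z := 0) (by simpa using hr0.le)
    rw [expMul_zero] at h1
    exact (eLpNorm_le_of_norm_le_exp_mul hp (inv_nonneg.2 hr0.le) hμm hpair.1.1.2 b f _ h1).trans_lt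
      (ENNReal.mul_lt_top ENNReal.ofReal_lt_top hf.2)
  obtain ⟨hbd, -, -⟩ := hT1 _ (memLp_of_eLpNorm_lt_top hbf)
  refine ⟨⟨hfd, hbd⟩, ?_⟩
  have hval : flagCommutator b T ⟨f, ⟨hfd, hbd⟩⟩ = flagMul b (S f) - S (flagMul b f) := by
    rw [hS' f hfd, hS' _ hbd]; rfl
  rw [hval]
  refine (eLpNorm_commutator_le hp hr0 hμm hpair.1.1.2 hlm hpair.2.1.1.2 (hT1.weightedBound hS')
    (fun z hz => (hT2 z hz).weightedBound hS') hf.2).trans (le_of_eq ?_)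
  congr 1
  rw [commutatorConst, ← hMdef, ENNReal.coe_mul, mul_assoc, div_eq_mul_inv,
    ← ENNReal.ofReal_inv_of_pos hr0]
  congr 1
  change _ = ENNReal.ofReal _ * ENNReal.ofReal B
  rw [← ENNReal.ofReal_mul (by positivity), hr, inv_div, ← hδdef]
  congr 1
  ring

/-- The commutator of an operator satisfying the hypothesis satisfies it with another constant. -/
theorem boundedBetween_flagCommutator (hp : 1 < p)
    (hC : ∀ s s' t t' : ℝ≥0, s ≤ s' → t ≤ t' → C s t ≤ C s' t')
    (hT : ∀ μ lam : FlagSpace n m → ℝ, IsWeightPair p ν μ lam →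
      BoundedBetween p T μ lam (C (flagApChar p μ).toNNReal (flagApChar p lam).toNNReal))
    (hpair : IsWeightPair p ν μ lam) (hb : MemFlagBmo b) :
    BoundedBetween p (flagCommutator b T) μ lam
      (commutatorConst n m p C (flagApChar p μ).toNNReal (flagApChar p lam).toNNReal *
        flagBmoNorm b) := by
  intro f hf
  have key : ∀ B : ℝ, (flagBmoNorm b).toReal < B → _ := fun B hB =>
    flagCommutator_bound_of_lt (B := B) hp hC hT hpair hb.1 (ENNReal.toReal_nonneg.trans_lt hB)
      ((ENNReal.le_ofReal_iff_toReal_le hb.2.ne (ENNReal.toReal_nonneg.trans hB.le)).2 hB.le) hf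
  obtain ⟨hdom, -⟩ := key _ (lt_add_one _)
  have hle : eLpNorm (flagCommutator b T ⟨f, hdom⟩) (ENNReal.ofReal p) (weightMeasure lam) ≤
      (commutatorConst n m p C (flagApChar p μ).toNNReal (flagApChar p lam).toNNReal : ℝ≥0∞) *
        flagBmoNorm b * eLpNorm f (ENNReal.ofReal p) (weightMeasure μ) := by
    -- The radius requires `B > 0`, while the bmo norm may vanish. The bound is therefore taken for
    -- every `B` above the norm, and `B` decreases to it.
    have hlim : Filter.Tendsto (fun B : ℝ =>
        (commutatorConst n m p C (flagApChar p μ).toNNReal (flagApChar p lam).toNNReal : ℝ≥0∞) *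
          ENNReal.ofReal B * eLpNorm f (ENNReal.ofReal p) (weightMeasure μ))
        (nhdsWithin (flagBmoNorm b).toReal (Set.Ioi (flagBmoNorm b).toReal))
        (nhds ((commutatorConst n m p C (flagApChar p μ).toNNReal
          (flagApChar p lam).toNNReal : ℝ≥0∞) *
          ENNReal.ofReal (flagBmoNorm b).toReal *
            eLpNorm f (ENNReal.ofReal p) (weightMeasure μ))) := by
      refine ENNReal.Tendsto.mul_const (ENNReal.Tendsto.const_mul ?_ (Or.inr ENNReal.coe_ne_top))
        (Or.inr hf.2.ne)
      exact (ENNReal.continuous_ofReal.tendsto _).mono_left nhdsWithin_le_nhds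
    rw [ENNReal.ofReal_toReal hb.2.ne] at hlim
    refine ge_of_tendsto hlim ?_
    filter_upwards [self_mem_nhdsWithin] with B hB
    obtain ⟨_, h⟩ := key B hB
    exact h
  refine ⟨hdom, memLp_of_eLpNorm_lt_top (hle.trans_lt ?_), hle⟩
  exact ENNReal.mul_lt_top (ENNReal.mul_lt_top ENNReal.coe_lt_top hb.2) hf.2

end Step

/-- Induction on `k`. The commutator bound holds for all admissible pairs with the same `ν`, so it
reproduces the hypothesis needed for the next commutator. -/
theorem exists_boundedBetween_iteratedCommutator {p : ℝ} (hp : 1 < p) {C : ℝ≥0 → ℝ≥0 → ℝ≥0}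
    (hC : ∀ s s' t t' : ℝ≥0, s ≤ s' → t ≤ t' → C s t ≤ C s' t') (k : ℕ) :
    ∃ C' : ℝ≥0 → ℝ≥0 → ℝ≥0,
      (∀ s s' t t' : ℝ≥0, s ≤ s' → t ≤ t' → C' s t ≤ C' s' t') ∧
      ∀ (ν : FlagSpace n m → ℝ) (T : FlagFun n m →ₗ.[ℂ] FlagFun n m),
        (∀ μ lam : FlagSpace n m → ℝ, IsWeightPair p ν μ lam →
          BoundedBetween p T μ lam
            (C (flagApChar p μ).toNNReal (flagApChar p lam).toNNReal)) →
        ∀ b : Fin k → FlagFun n m, (∀ j, MemFlagBmo (b j)) →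
        ∀ μ lam : FlagSpace n m → ℝ, IsWeightPair p ν μ lam →
          BoundedBetween p (iteratedCommutator k b T) μ lam
            (C' (flagApChar p μ).toNNReal (flagApChar p lam).toNNReal *
              ∏ j, flagBmoNorm (b j)) := by
  induction k with
  | zero =>
    refine ⟨C, hC, fun ν T hT b _ μ lam hpair => ?_⟩
    simpa [iteratedCommutator] using hT μ lam hpair
  | succ k ih =>
    obtain ⟨C', hC', h⟩ := ih
    refine ⟨commutatorConst n m p C', commutatorConst_mono hp hC',
      fun ν T hT b hb μ lam hpair => ?_⟩
    set P : ℝ≥0∞ := ∏ j : Fin k, flagBmoNorm (b j.castSucc) with hP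
    have hPt : P ≠ ∞ := ENNReal.prod_ne_top fun j _ => (hb j.castSucc).2.ne
    have h1 := h ν T hT (fun j => b j.castSucc) fun j => hb j.castSucc
    rw [← hP] at h1
    -- The inner commutator enters with constant function `C'` times the product `P` of its bmo
    -- norms; `P` is then factored out again by homogeneity.
    have h2 := boundedBetween_flagCommutator (b := b (Fin.last k))
      (C := fun s t => C' s t * P.toNNReal) hp
      (fun s s' t t' hs ht => by gcongr; exact hC' _ _ _ _ hs ht)
      (fun μ lam hpair => by
        have := h1 μ lam hpair
        rwa [ENNReal.coe_mul, ENNReal.coe_toNNReal hPt]) hpair (hb _)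
    rw [commutatorConst_mul, ENNReal.coe_mul, ENNReal.coe_toNNReal hPt, mul_assoc] at h2
    rw [Fin.prod_univ_castSucc]
    exact h2

end

theorem mainTheorem3 (n m : ℕ) (hn : 1 ≤ n) (hm : 1 ≤ m) (p : ℝ) (hp : 1 < p)
    (C : ℝ≥0 → ℝ≥0 → ℝ≥0)
    (hC : ∀ s s' t t' : ℝ≥0, s ≤ s' → t ≤ t' → C s t ≤ C s' t')
    (k : ℕ) (hk : 1 ≤ k) :
    ∃ C' : ℝ≥0 → ℝ≥0 → ℝ≥0,
      (∀ s s' t t' : ℝ≥0, s ≤ s' → t ≤ t' → C' s t ≤ C' s' t') ∧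
      ∀ (ν : FlagSpace n m → ℝ), IsFlagWeight ν →
      ∀ (T : FlagFun n m →ₗ.[ℂ] FlagFun n m),
        (∀ μ lam : FlagSpace n m → ℝ, IsWeightPair p ν μ lam →
          BoundedBetween p T μ lam
            (C (flagApChar p μ).toNNReal (flagApChar p lam).toNNReal)) →
        ∀ b : Fin k → FlagFun n m, (∀ j, MemFlagBmo (b j)) →
        ∀ μ lam : FlagSpace n m → ℝ, IsWeightPair p ν μ lam →
          BoundedBetween p (iteratedCommutator k b T) μ lam
            (C' (flagApChar p μ).toNNReal (flagApChar p lam).toNNReal *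
              ∏ j, flagBmoNorm (b j)) := by
  obtain ⟨C', hC', h⟩ := exists_boundedBetween_iteratedCommutator (n := n) (m := m) hp hC k
  exact ⟨C', hC', fun ν _ => h ν⟩
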